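/- **Functions $G_r$.** For $r\ge 0$, $z\in\mathbb C$ and $\underline\tau=(\tau_0,\dots,\tau_r)$ in the upper half-plane, put $x=e^{2i\pi z}$, $q_j=e^{2i\pi\tau_j}$ and $$G_r(z,\underline\tau)=\prod_{m_0,\dots,m_r\ge 0}\bigl(1-q_0^{m_0+1}\cdots q_r^{m_r+1}x^{-1}\bigr)\bigl(1-q_0^{m_0}\cdots q_r^{m_r}x\bigr)^{(-1)^r},$$ extended to $\underline\tau\in(\mathbb C\setminus\mathbb R)^{r+1}$ by $G_r(z,(\tau_0,\dots,-\tau_j,\dots,\tau_r))=G_r(z+\tau_j,\underline\tau)^{-1}$. **Geometric functions.** Let $L$ be a free $\mathbb Z$-module of rank $r+2$ with a basis, let $\Lambda=\mathrm{Hom}_{\mathbb Z}(L,\mathbb Z)$, oriented by the determinant in the dual basis, and let $\underline a=(a_0,\dots,a_r)$ be linearly independent primitive vectors of $\Lambda$. Let $\gamma\in L$ be the primitive vector such that $\det(\underline a,c)=s\,c(\gamma)$ for all $c\in\Lambda$, with an integer $s>0$. A positive dual family to $\underline a$ is a family $\underline\alpha=(\alpha_0,\dots,\alpha_r)$ in $L$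 with $a_j(\alpha_j)>0$ and $a_k(\alpha_j)=0$ for $k\ne j$. With any such family, for $w\in\mathbb C$ and $x\in\mathrm{Hom}_{\mathbb Z}(L,\mathbb C)$, put $$G_{r,\underline a}(w,x,\Lambda)=\prod_{\delta\in F(\underline\alpha)/\mathbb Z\gamma}G_r\!\left(\frac{w+x(\delta)}{x(\gamma)},\frac{x(\alpha_0)}{x(\gamma)},\dots,\frac{x(\alpha_r)}{x(\gamma)}\right),\qquad F(\underline\alpha)=\{\delta\in L:\ 0\le a_j(\delta)<a_j(\alpha_j)\ \text{for } 0\le j\le r\}.$$ **Arithmetic functions.** Let $K$ be a number field of degree $r+2\ge 2$ with exactly one complex place, and fix an ordering $\sigma_1,\dots,\sigma_r,\sigma_{r+1}=\sigma_{\mathbb C},\sigma_{r+2}=\overline{\sigma_{\mathbb C}}$ of its embeddings, the first $r$ being real. A $\mathbb Q$-basis $(e_k)$ of $K$ is called positive if $i\det(\sigma_j(e_k))>0$. Let $\mathfrak f\ne\mathcal O_K$ be a nonzero ideal of $\mathcal O_K$, let $q>0$ be such that $q\mathbb Z=\mathfrak f\cap\mathbb Z$, let $\mathfrak b$ be an integral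 ideal coprime to $\mathfrak f$, put $L=\mathfrak f\mathfrak b^{-1}$, and let $\mathfrak a$ be an integral ideal coprime to $\mathfrak f\mathfrak b$ such that $\mathfrak a^{-1}L/L$ is cyclic; put $N=\mathcal N(\mathfrak a)$. A vector $h\in L$ is admissible if $h/q\equiv 1 \bmod L$ and $h/N$ generates $\mathfrak a^{-1}L/L$. Let $u_1,\dots,u_r\in\mathcal O_K^\times$ be such that $1,u_1,\dots,u_r$ are linearly independent over $\mathbb Q$. For a nonzero $h\in L$, let $a$ be the primitive element of $\mathrm{Hom}_{\mathbb Z}(L,\mathbb Z)$ with $na=\det_{B_L}(h,u_1h,\dots,u_rh,\cdot)$ for an integer $n>0$, where $B_L$ is a positive $\mathbb Z$-basis of $L$, and let $au_j$ be the form $v\mapsto a(u_jv)$. For $\mu\in\{\pm1\}$ put $$G^{\mu}_{r,\mathfrak f,\mathfrak b,\mathfrak a}(u_1,\dots,u_r;h)=\frac{G_{r,(\mu a,\mu au_1,\dots,\mu au_r)}\bigl(\sigma_{\mathbb C}(h/q),\sigma_{\mathbb C},\mathrm{Hom}_{\mathbb Z}(L,\mathbb Z)\bigr)^{N}}{G_{r,(\mu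 a,\mu au_1,\dots,\mu au_r)}\bigl(\sigma_{\mathbb C}(h/q),\sigma_{\mathbb C},\mathrm{Hom}_{\mathbb Z}(\mathfrak a^{-1}L,\mathbb Z)\bigr)},$$ where the lattices $L$ and $\mathfrak a^{-1}L$ are given positive bases, and where the forms are extended to $\mathfrak a^{-1}L$ by linearity (for $h$ admissible, or a unit times an admissible vector, they are integral there). **Statement.** Let $h$ be admissible for $\mathfrak f,\mathfrak b,\mathfrak a$, and suppose that the function above is defined at $h$, i.e. that $\sigma_{\mathbb C}(\alpha_j/h)\notin\mathbb R$ for all $0\le j\le r$ whenever $\underline\alpha$ is a positive dual family in $L$ to $(a,au_1,\dots,au_r)$. Then for all orientations $\mu,\nu\in\{\pm1\}$ and every unit $\varepsilon\in\mathcal O_K^\times$, $$G^{\mu}_{r,\mathfrak f,\mathfrak b,\mathfrak a}(u_1,\dots,u_r;\varepsilon h)^{\nu}=G^{\mu\,\mathcal N(\varepsilon)}_{r,\mathfrak f,\mathfrak b,\mathfrak a}(u_1,\dots,u_r;h)^{\nu\,\mathcal N(\varepsilon)}.$$ -/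

import Mathlib

open scoped nonZeroDivisors

namespace MultEllGamma

noncomputable section

/-! ### The multiple elliptic Gamma functions -/

/-- The function `G_r(z, τ)` for `τ` in the `(r+1)`-st power of the upper half-plane: with
`q_j = exp (2 i π τ_j)` and `x = exp (2 i π z)`, it is
`∏_{m ≥ 0} (1 - q^(m+1) x⁻¹) * (∏_{m ≥ 0} (1 - q^m x)) ^ ((-1)^r)`,
both products being absolutely convergent. -/
def GUpper {r : ℕ} (z : ℂ) (τ : Fin (r + 1) → ℂ) : ℂ :=
  (∏' m : Fin (r + 1) → ℕ,
      (1 - (∏ j, Complex.exp (2 * Real.pi * Complex.I * τ j) ^ (m j + 1)) *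
        (Complex.exp (2 * Real.pi * Complex.I * z))⁻¹)) *
  (∏' m : Fin (r + 1) → ℕ,
      (1 - (∏ j, Complex.exp (2 * Real.pi * Complex.I * τ j) ^ m j) *
        Complex.exp (2 * Real.pi * Complex.I * z))) ^ ((-1 : ℤ) ^ r)

/-- The function `G_r(z, τ)` for `τ` in `(ℂ - ℝ)^(r+1)`. It is the extension of `GUpper` by the rule
`G_r(z, (τ_0, …, -τ_j, …, τ_r)) = G_r(z + τ_j, τ)⁻¹`, applied to all the `τ_j` which lie
in the lower half-plane. -/
def G {r : ℕ} (z : ℂ) (τ : Fin (r + 1) → ℂ) : ℂ :=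
  GUpper (z - ∑ j with (τ j).im < 0, τ j) (fun j => if (τ j).im < 0 then -τ j else τ j) ^
    ((-1 : ℤ) ^ (Finset.univ.filter (fun j => (τ j).im < 0)).card)

/-! ### The geometric functions

Let `V` be a `ℚ`-vector space of dimension `r + 2` with a basis `B`. Its integral span is a lattice
`L`; the lattice `Λ = Hom(L, ℤ)` is seen as the set of linear forms on `V` which are integral
on `L`, so that `Hom(Λ, ℤ) = L`, and `Λ` is oriented by the basis dual to `B`. -/

variable {V : Type*} [AddCommGroup V] [Module ℚ V]

/-- The lattice `L` spanned by a basis `B`. -/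
def lattice {n : ℕ} (B : Module.Basis (Fin n) ℚ V) : Submodule ℤ V :=
  Submodule.span ℤ (Set.range B)

/-- The lattice `Λ = Hom(L, ℤ)`, inside the space of linear forms on `V`. -/
def dualLattice {n : ℕ} (B : Module.Basis (Fin n) ℚ V) : Submodule ℤ (Module.Dual ℚ V) :=
  Submodule.span ℤ (Set.range B.dualBasis)

/-- `dualLattice B` consists of the linear forms which take integral values on `lattice B`. -/
theorem mem_dualLattice_iff {n : ℕ} (B : Module.Basis (Fin n) ℚ V) (f : Module.Dual ℚ V) :
    f ∈ dualLattice B ↔ ∀ v ∈ lattice B, ∃ k : ℤ, f v = k := by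
  unfold dualLattice lattice
  rw [B.dualBasis.mem_span_iff_repr_mem ℤ]
  simp only [Module.Basis.dualBasis_repr]
  constructor
  · intro h v hv
    induction hv using Submodule.span_induction with
    | mem x hx =>
      obtain ⟨i, rfl⟩ := hx
      obtain ⟨k, hk⟩ := h i
      exact ⟨k, by simpa using hk.symm⟩
    | zero => exact ⟨0, by simp⟩
    | add x y _ _ hx hy =>
      obtain ⟨k, hk⟩ := hx
      obtain ⟨l, hl⟩ := hy
      exact ⟨k + l, by simp [hk, hl]⟩
    | smul c x _ hx =>
      obtain ⟨k, hk⟩ := hx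
      exact ⟨c * k, by simp [hk]⟩
  · intro h i
    obtain ⟨k, hk⟩ := h (B i) (Submodule.subset_span ⟨i, rfl⟩)
    exact ⟨k, by simpa using hk.symm⟩

/-- A primitive vector of a lattice: it is only divisible by `1` and `-1` in the lattice. -/
def IsPrimitive {W : Type*} [AddCommGroup W] (M : Submodule ℤ W) (v : W) : Prop :=
  v ∈ M ∧ ∀ n : ℤ, ∀ w ∈ M, v = n • w → n = 1 ∨ n = -1

/-- The characterization of the primitive vector `γ` of `L` attached to `a = (a_0, …, a_r)`:
`det(a_0, …, a_r, c) = s c(γ)` for all forms `c` and some integer `s > 0`, where `det` is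
the determinant in the basis dual to `B`. -/
def IsNormalVector {r : ℕ} (B : Module.Basis (Fin (r + 2)) ℚ V) (a : Fin (r + 1) → Module.Dual ℚ V)
    (γ : V) : Prop :=
  IsPrimitive (lattice B) γ ∧ ∃ s : ℤ, 0 < s ∧
    ∀ c : Module.Dual ℚ V,
      B.dualBasis.det (Fin.snoc (α := fun _ => Module.Dual ℚ V) a c) = s * c γ

/-- Positive dual families `(α_0, …, α_r)` in `L` to `a = (a_0, …, a_r)`. -/
def IsPositiveDualFamily {r : ℕ} (B : Module.Basis (Fin (r + 2)) ℚ V)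
    (a : Fin (r + 1) → Module.Dual ℚ V) (α : Fin (r + 1) → V) : Prop :=
  ∀ j, α j ∈ lattice B ∧ 0 < a j (α j) ∧ ∀ k, k ≠ j → a k (α j) = 0

/-- The set `F(α)` of vectors `δ` of `L` with `0 ≤ a_j(δ) < a_j(α_j)` for all `j`. -/
def fundSet {r : ℕ} (B : Module.Basis (Fin (r + 2)) ℚ V)
    (a : Fin (r + 1) → Module.Dual ℚ V) (α : Fin (r + 1) → V) : Set V :=
  {δ | δ ∈ lattice B ∧ ∀ j, 0 ≤ a j δ ∧ a j δ < a j (α j)}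

/-- The product of the `G_r((w + δ(x)) / γ(x), α(x) / γ(x))` over the classes `δ` in the finite
quotient `F(α) / ℤ γ`; a factor does not depend on the choice of `δ` in its class since
`G_r` is `1`-periodic in its first variable. -/
def geomProduct {r : ℕ} (B : Module.Basis (Fin (r + 2)) ℚ V) (a : Fin (r + 1) → Module.Dual ℚ V)
    (γ : V) (α : Fin (r + 1) → V) (w : ℂ) (x : V →ₗ[ℚ] ℂ) : ℂ :=
  ∏ᶠ δ ∈ (Submodule.span ℤ {γ}).mkQ '' fundSet B a α,
    G ((w + x (Quotient.out δ)) / x γ) (fun j => x (α j) / x γ)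

open Classical in
/-- The primitive vector `γ` attached to `a` (it is unique when it exists). -/
def normalVector {r : ℕ} (B : Module.Basis (Fin (r + 2)) ℚ V)
    (a : Fin (r + 1) → Module.Dual ℚ V) : V :=
  if h : ∃ γ, IsNormalVector B a γ then h.choose else 0

open Classical in
/-- An arbitrary positive dual family to `a`. -/
def dualFamily {r : ℕ} (B : Module.Basis (Fin (r + 2)) ℚ V)
    (a : Fin (r + 1) → Module.Dual ℚ V) : Fin (r + 1) → V :=
  if h : ∃ α, IsPositiveDualFamily B a α then h.choose else 0

/-- The geometric function `G_{r, a}(w, x, Λ)`, computed with an arbitrary positive dual family. -/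
def geomG {r : ℕ} (B : Module.Basis (Fin (r + 2)) ℚ V) (a : Fin (r + 1) → Module.Dual ℚ V)
    (w : ℂ) (x : V →ₗ[ℚ] ℂ) : ℂ :=
  geomProduct B a (normalVector B a) (dualFamily B a) w x

/-! ### Number fields with exactly one complex place -/

variable {K : Type*} [Field K] [NumberField K]

/-- An ordering `σ_1, …, σ_r, σ_ℂ, conj σ_ℂ` of the embeddings of a number field `K` of degree
`r + 2` with exactly one complex place. -/
structure ATROrdering (K : Type*) [Field K] [NumberField K] (r : ℕ) where
  /-- The embeddings, in order. -/
  emb : Fin (r + 2) → (K →+* ℂ)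
  bijective : Function.Bijective emb
  isReal : ∀ j : Fin r, NumberField.ComplexEmbedding.IsReal (emb j.castSucc.castSucc)
  not_isReal : ¬ NumberField.ComplexEmbedding.IsReal (emb (Fin.last r).castSucc)
  conj : emb (Fin.last (r + 1)) =
    NumberField.ComplexEmbedding.conjugate (emb (Fin.last r).castSucc)

/-- The complex embedding `σ_ℂ`. -/
def ATROrdering.sigmaC {r : ℕ} (σ : ATROrdering K r) : K →+* ℂ := σ.emb (Fin.last r).castSucc

/-- A basis `(e_k)` of `K` over `ℚ` is positive if the (real) number `i det (σ_j(e_k))` is. -/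
def IsPositiveBasis {r : ℕ} (σ : ATROrdering K r) (B : Module.Basis (Fin (r + 2)) ℚ K) : Prop :=
  0 < (Complex.I * (Matrix.of fun j k => σ.emb j (B k)).det).re

/-- `B` is a `ℤ`-basis of the fractional ideal `I`. -/
def IsIntegralBasisOf {n : ℕ} (B : Module.Basis (Fin n) ℚ K)
    (I : FractionalIdeal (NumberField.RingOfIntegers K)⁰ K) : Prop :=
  ∀ x : K, x ∈ lattice B ↔ x ∈ I

/-- `g` is in `I` and its class generates the group `I / J`, for `J ⊆ I`. -/
def GeneratesQuotient (I J : FractionalIdeal (NumberField.RingOfIntegers K)⁰ K) (g : K) : Prop :=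
  g ∈ I ∧ ∀ x ∈ I, ∃ n : ℤ, x - n • g ∈ J

/-- The fractional ideal `L = 𝔣 𝔟⁻¹`. -/
def idealL (𝔣 𝔟 : Ideal (NumberField.RingOfIntegers K)) :
    FractionalIdeal (NumberField.RingOfIntegers K)⁰ K :=
  (𝔣 : FractionalIdeal (NumberField.RingOfIntegers K)⁰ K) *
    (𝔟 : FractionalIdeal (NumberField.RingOfIntegers K)⁰ K)⁻¹

/-- The fractional ideal `𝔞⁻¹ L = 𝔣 (𝔟 𝔞)⁻¹`. -/
def idealAL (𝔣 𝔟 𝔞 : Ideal (NumberField.RingOfIntegers K)) :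
    FractionalIdeal (NumberField.RingOfIntegers K)⁰ K :=
  (𝔣 : FractionalIdeal (NumberField.RingOfIntegers K)⁰ K) *
    ((𝔟 * 𝔞 : Ideal (NumberField.RingOfIntegers K)) :
      FractionalIdeal (NumberField.RingOfIntegers K)⁰ K)⁻¹

/-- The nonnegative generator `q` of the ideal `ℤ ∩ 𝔣` of `ℤ`. -/
def levelQ (𝔣 : Ideal (NumberField.RingOfIntegers K)) : ℕ :=
  Ideal.absNorm (𝔣.comap (algebraMap ℤ (NumberField.RingOfIntegers K)))

/-- Admissible vectors for `𝔣`, `𝔟`, `𝔞`. -/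
def IsAdmissible (𝔣 𝔟 𝔞 : Ideal (NumberField.RingOfIntegers K)) (h : K) : Prop :=
  h ∈ idealL 𝔣 𝔟 ∧ h / (levelQ 𝔣 : K) - 1 ∈ idealL 𝔣 𝔟 ∧
    GeneratesQuotient (idealAL 𝔣 𝔟 𝔞) (idealL 𝔣 𝔟) (h / (Ideal.absNorm 𝔞 : K))

/-- The family `(u_0 = 1, u_1, …, u_r)` in `K`. -/
def unitFamily {r : ℕ} (u : Fin r → (NumberField.RingOfIntegers K)ˣ) : Fin (r + 1) → K :=
  Fin.cons 1 (fun j => ((u j : NumberField.RingOfIntegers K) : K))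

/-- The characterization of the linear form `a`: it is primitive in `Hom(L, ℤ)` and
`n a = det_B(h, u_1 h, …, u_r h, ·)` for some integer `n > 0`. -/
def IsLinearForm {r : ℕ} (B : Module.Basis (Fin (r + 2)) ℚ K)
    (u : Fin r → (NumberField.RingOfIntegers K)ˣ) (h : K) (a : Module.Dual ℚ K) : Prop :=
  IsPrimitive (dualLattice B) a ∧ ∃ n : ℤ, 0 < n ∧
    ∀ v : K, n * a v = B.det (Fin.snoc (α := fun _ => K) (fun j => unitFamily u j * h) v)

open Classical in
/-- The linear form `a` (it is unique when it exists). -/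
def linearForm {r : ℕ} (B : Module.Basis (Fin (r + 2)) ℚ K)
    (u : Fin r → (NumberField.RingOfIntegers K)ˣ) (h : K) : Module.Dual ℚ K :=
  if H : ∃ a, IsLinearForm B u h a then H.choose else 0

/-- The family `(a, a u_1, …, a u_r)`, where `a u_j` is the form `v ↦ a (u_j v)`. -/
def formFamily {r : ℕ} (B : Module.Basis (Fin (r + 2)) ℚ K)
    (u : Fin r → (NumberField.RingOfIntegers K)ˣ) (h : K) : Fin (r + 1) → Module.Dual ℚ K :=
  fun j => (linearForm B u h).comp (LinearMap.mulLeft ℚ (unitFamily u j))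

/-- The arithmetic function `G^μ_{r, 𝔣, 𝔟, 𝔞}(u_1, …, u_r; h, σ_ℂ)`, for the orientation `μ = ±1`;
`B` and `B'` are positive `ℤ`-bases of `L = 𝔣 𝔟⁻¹` and of `𝔞⁻¹ L`. The forms `a u_j` are
attached to `L`, and they are used for both lattices. -/
def arithG {r : ℕ} (σ : ATROrdering K r) (𝔣 𝔞 : Ideal (NumberField.RingOfIntegers K))
    (B B' : Module.Basis (Fin (r + 2)) ℚ K) (μ : ℤˣ)
    (u : Fin r → (NumberField.RingOfIntegers K)ˣ) (h : K) : ℂ :=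
  geomG B (fun j => (μ : ℤ) • formFamily B u h j) (σ.sigmaC (h / (levelQ 𝔣 : K)))
      σ.sigmaC.toRatAlgHom.toLinearMap ^ Ideal.absNorm 𝔞 /
    geomG B' (fun j => (μ : ℤ) • formFamily B u h j) (σ.sigmaC (h / (levelQ 𝔣 : K)))
      σ.sigmaC.toRatAlgHom.toLinearMap

end

end MultEllGamma

open MultEllGamma

namespace MultEllGamma

noncomputable section

/-! ### Infinite products over `ℕ ^ ι` -/

/-! Write `η` for the norm of `ε`. Multiplication by `ε` is an automorphism of both `L` and `𝔞⁻¹L`,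
of determinant `η`. Pulling it out of `det(h, u_1 h, …, u_r h, ·)` shows that the form attached to
`εh` is `η a ∘ ε⁻¹` (`IsLinearForm.units_mul`), so the family for `(μ, εh)` is the transport by `ε`
of the family for `(μη, h)`.

Transport carries a dual family `α` to `εα`, representatives `δ` to `εδ`, and the normal vector `γ`
to `η εγ`, the sign coming from the determinant. As `σ_ℂ` multiplies by `σ_ℂ(ε)`, which cancels in
the quotients, each factor `G_r(z, τ)` becomes `G_r(ηz, ητ)`. This is `G_r(z, τ)^η`, because `G_r`
inverts when all its variables change sign (`G_neg`). Hence each geometric function is raised to the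
power `η` (`geomG_comp_symm`), and so is their quotient.

One point needs work: `geomG` uses an arbitrarily chosen dual family, and the choice need not
commute with transport. Two dual families satisfy `n_j α_j + m_j γ = n'_j α'_j` with `n_j, n'_j >
0`, and passing from `α_j` to `n_j α_j + m_j γ` preserves the product by the multiplication formula
`G_eq_prod`. This gives `geomProduct_eq_of_isPositiveDualFamily`, valid when the periods are not
real; `im_div_ne_zero_of_isNormalVector` derives that condition for both lattices from the
hypothesis on `h`. -/

theorem summable_prod_pow {n : ℕ} (a : Fin n → ℝ) (h0 : ∀ j, 0 ≤ a j) (h1 : ∀ j, a j < 1) :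
    Summable fun m : Fin n → ℕ => ∏ j, a j ^ m j := by
  induction n with
  | zero => exact Summable.of_finite
  | succ n ih =>
    have h := (summable_geometric_of_lt_one (h0 0) (h1 0)).mul_of_nonneg
      (ih (fun j => a j.succ) (fun j => h0 _) (fun j => h1 _))
      (fun i => pow_nonneg (h0 0) i)
      (fun m => Finset.prod_nonneg fun j _ => pow_nonneg (h0 _) _)
    rw [← (Fin.consEquiv fun _ : Fin (n + 1) => ℕ).summable_iff]
    refine h.congr fun p => ?_
    simp [Fin.consEquiv, Fin.prod_univ_succ]

/-- The product of the `1 - q ^ m y` over all the multi-indices `m`. -/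
def qProd {n : ℕ} (q : Fin n → ℂ) (y : ℂ) : ℂ :=
  ∏' m : Fin n → ℕ, (1 - (∏ j, q j ^ m j) * y)

theorem multipliable_qProd {n : ℕ} (q : Fin n → ℂ) (hq : ∀ j, ‖q j‖ < 1) (y : ℂ) :
    Multipliable fun m : Fin n → ℕ => (1 - (∏ j, q j ^ m j) * y) := by
  have h : Summable fun m : Fin n → ℕ => ‖-((∏ j, q j ^ m j) * y)‖ := by
    simp only [norm_neg, norm_mul, norm_prod, norm_pow]
    exact (summable_prod_pow _ (fun j => norm_nonneg _) hq).mul_right _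
  simpa [sub_eq_add_neg] using multipliable_one_add_of_summable h

/-- Euclidean division of a multi-index by a family of positive integers. -/
def divModPiEquiv {ι : Type*} (n : ι → ℕ) (hn : ∀ j, 0 < n j) :
    (ι → ℕ) × (∀ j, Fin (n j)) ≃ (ι → ℕ) where
  toFun p j := p.1 j * n j + p.2 j
  invFun m := (fun j => m j / n j, fun j => ⟨m j % n j, Nat.mod_lt _ (hn j)⟩)
  left_inv p := by
    ext j
    · simp only
      rw [add_comm, Nat.add_mul_div_right _ _ (hn j), Nat.div_eq_of_lt (p.2 j).2, zero_add]
    · simp only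
      rw [add_comm, Nat.add_mul_mod_self_right, Nat.mod_eq_of_lt (p.2 j).2]
  right_inv m := by
    funext j
    simp only
    rw [mul_comm]
    exact Nat.div_add_mod _ _

/-- Each exponent is split by Euclidean division by `N j`; absolute convergence allows the
regrouping by remainders. This is the source of the multiplication formula for `G`. -/
theorem qProd_eq_prod {n : ℕ} (q : Fin n → ℂ) (hq : ∀ j, ‖q j‖ < 1) (y : ℂ) (N : Fin n → ℕ)
    (hN : ∀ j, 0 < N j) :
    qProd q y = ∏ k : ∀ j, Fin (N j),
      qProd (fun j => q j ^ N j) ((∏ j, q j ^ (k j : ℕ)) * y) := by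
  have hq' : ∀ j, ‖q j ^ N j‖ < 1 := fun j => by
    rw [norm_pow]
    exact pow_lt_one₀ (norm_nonneg _) (hq j) (hN j).ne'
  obtain ⟨e, he⟩ : ∃ e : (Fin n → ℕ) × (∀ j, Fin (N j)) ≃ (Fin n → ℕ),
      ∀ m k j, e (m, k) j = m j * N j + (k j : ℕ) := ⟨divModPiEquiv N hN, fun _ _ _ => rfl⟩
  have hmul : Multipliable fun p : (Fin n → ℕ) × (∀ j, Fin (N j)) =>
      (1 - (∏ j, q j ^ e p j) * y) :=
    e.multipliable_iff.2 (multipliable_qProd q hq y)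
  have hterm : ∀ (m : Fin n → ℕ) (k : ∀ j, Fin (N j)),
      ∏ j, q j ^ e (m, k) j =
        (∏ j, (q j ^ N j) ^ m j) * ∏ j, q j ^ (k j : ℕ) := fun m k => by
    rw [← Finset.prod_mul_distrib]
    refine Finset.prod_congr rfl fun j _ => ?_
    rw [he, pow_add, ← pow_mul, mul_comm (m j)]
  calc qProd q y = ∏' p : (Fin n → ℕ) × (∀ j, Fin (N j)),
        (1 - (∏ j, q j ^ e p j) * y) :=
      (e.tprod_eq fun m => 1 - (∏ j, q j ^ m j) * y).symm
    _ = ∏' m : Fin n → ℕ, ∏ k : ∀ j, Fin (N j),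
        (1 - (∏ j, (q j ^ N j) ^ m j) * ((∏ j, q j ^ (k j : ℕ)) * y)) := by
      rw [hmul.tprod_prod' fun m => Multipliable.of_finite]
      refine tprod_congr fun m => ?_
      rw [tprod_fintype]
      refine Finset.prod_congr rfl fun k _ => ?_
      rw [hterm, mul_assoc]
    _ = ∏ k : ∀ j, Fin (N j), ∏' m : Fin n → ℕ,
        (1 - (∏ j, (q j ^ N j) ^ m j) * ((∏ j, q j ^ (k j : ℕ)) * y)) :=
      Multipliable.tprod_finsetProd fun k _ => multipliable_qProd _ hq' _

/-! ### Functional equations of the multiple elliptic Gamma functions -/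

/-- The map `z ↦ exp (2 i π z)`. -/
def cexp2pi (z : ℂ) : ℂ := Complex.exp (2 * Real.pi * Complex.I * z)

theorem cexp2pi_ne_zero (z : ℂ) : cexp2pi z ≠ 0 := Complex.exp_ne_zero _

theorem cexp2pi_add (z w : ℂ) : cexp2pi (z + w) = cexp2pi z * cexp2pi w := by
  simp [cexp2pi, mul_add, Complex.exp_add]

theorem cexp2pi_neg (z : ℂ) : cexp2pi (-z) = (cexp2pi z)⁻¹ := by
  simp [cexp2pi, Complex.exp_neg]

theorem cexp2pi_int (m : ℤ) : cexp2pi m = 1 := by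
  rw [cexp2pi, Complex.exp_eq_one_iff]
  exact ⟨m, by ring⟩

theorem cexp2pi_nat_mul (m : ℕ) (z : ℂ) : cexp2pi (m * z) = cexp2pi z ^ m := by
  rw [cexp2pi, cexp2pi, ← Complex.exp_nat_mul]
  ring_nf

theorem cexp2pi_sum {ι : Type*} (s : Finset ι) (f : ι → ℂ) :
    cexp2pi (∑ j ∈ s, f j) = ∏ j ∈ s, cexp2pi (f j) := by
  simp [cexp2pi, Finset.mul_sum, Complex.exp_sum]

theorem norm_cexp2pi_lt_one {z : ℂ} (hz : 0 < z.im) : ‖cexp2pi z‖ < 1 := by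
  rw [cexp2pi, Complex.norm_exp, Real.exp_lt_one_iff]
  have : (2 * Real.pi * Complex.I * z).re = -(2 * Real.pi * z.im) := by
    simp [Complex.mul_re]
  rw [this]
  have := mul_pos Real.two_pi_pos hz
  linarith

theorem GUpper_eq {r : ℕ} (z : ℂ) (τ : Fin (r + 1) → ℂ) :
    GUpper z τ = qProd (fun j => cexp2pi (τ j)) ((∏ j, cexp2pi (τ j)) * (cexp2pi z)⁻¹) *
      qProd (fun j => cexp2pi (τ j)) (cexp2pi z) ^ ((-1 : ℤ) ^ r) := by
  unfold GUpper qProd cexp2pi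
  congr 1
  refine tprod_congr fun m => ?_
  rw [← mul_assoc, ← Finset.prod_mul_distrib]
  simp only [pow_succ]

theorem GUpper_congr {r : ℕ} {z z' : ℂ} {τ τ' : Fin (r + 1) → ℂ} (hz : cexp2pi z = cexp2pi z')
    (hτ : ∀ j, cexp2pi (τ j) = cexp2pi (τ' j)) : GUpper z τ = GUpper z' τ' := by
  simp only [GUpper_eq, hz, hτ]

/-- The substitution `x ↦ q_0 ⋯ q_r x⁻¹` exchanges the two infinite products, up to the exponent
`(-1)^r`. -/
theorem GUpper_reflect {r : ℕ} (z : ℂ) (τ : Fin (r + 1) → ℂ) :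
    GUpper (∑ j, τ j - z) τ = GUpper z τ ^ ((-1 : ℤ) ^ r) := by
  have hP : (∏ j, cexp2pi (τ j)) ≠ 0 := Finset.prod_ne_zero_iff.2 fun j _ => cexp2pi_ne_zero _
  have hx := cexp2pi_ne_zero z
  rw [GUpper_eq, GUpper_eq, sub_eq_add_neg, cexp2pi_add, cexp2pi_neg, cexp2pi_sum, mul_zpow,
    ← zpow_mul, ← mul_pow]
  have : (∏ j, cexp2pi (τ j)) * ((∏ j, cexp2pi (τ j)) * (cexp2pi z)⁻¹)⁻¹ = cexp2pi z := by
    field_simp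
  rw [this, mul_comm]
  simp

/-- Multiplying the periods by positive integers and adding integers to them, in the upper
half-plane. -/
theorem GUpper_eq_prod {r : ℕ} (z : ℂ) (τ τ' : Fin (r + 1) → ℂ) (hτ : ∀ j, 0 < (τ j).im)
    (n : Fin (r + 1) → ℕ) (hn : ∀ j, 0 < n j)
    (hτ' : ∀ j, cexp2pi (τ' j) = cexp2pi (τ j) ^ n j) :
    GUpper z τ = ∏ k : ∀ j, Fin (n j), GUpper (z + ∑ j, (k j : ℕ) * τ j) τ' := by
  have hq : ∀ j, ‖cexp2pi (τ j)‖ < 1 := fun j => norm_cexp2pi_lt_one (hτ j)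
  simp only [GUpper_eq, hτ']
  rw [Finset.prod_mul_distrib, Finset.prod_zpow, qProd_eq_prod _ hq _ n hn,
    qProd_eq_prod _ hq _ n hn]
  congr 1
  -- In the product in `x⁻¹` the remainders run backwards: `q · q^(n-1-k) = q^n / q^k`.
  · rw [← (Equiv.piCongrRight fun j => (Fin.revPerm : Equiv.Perm (Fin (n j)))).prod_comp]
    refine Finset.prod_congr rfl fun k _ => ?_
    congr 1
    rw [cexp2pi_add, cexp2pi_sum, mul_inv, ← mul_assoc, mul_right_comm, ← mul_assoc,
      mul_right_comm, ← Finset.prod_inv_distrib, ← Finset.prod_mul_distrib, mul_right_comm,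
      ← Finset.prod_mul_distrib]
    congr 1
    refine Finset.prod_congr rfl fun j _ => ?_
    rw [cexp2pi_nat_mul, ← div_eq_mul_inv, eq_div_iff (pow_ne_zero _ (cexp2pi_ne_zero _)),
      ← pow_succ, ← pow_add]
    congr 1
    have := (k j).2
    simp only [Equiv.piCongrRight_apply, Pi.map_apply, Fin.revPerm_apply, Fin.val_rev]
    omega
  · congr 1
    refine Finset.prod_congr rfl fun k _ => ?_
    congr 1
    rw [cexp2pi_add, cexp2pi_sum, mul_comm]
    simp only [cexp2pi_nat_mul]

theorem G_add_int {r : ℕ} (z : ℂ) (m : ℤ) (τ : Fin (r + 1) → ℂ) : G (z + m) τ = G z τ := by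
  unfold G
  congr 1
  refine GUpper_congr ?_ fun j => rfl
  rw [add_sub_right_comm, cexp2pi_add, cexp2pi_int, mul_one]

/-- `G_r` inverts under the simultaneous change of sign of all its variables. -/
theorem G_neg {r : ℕ} (z : ℂ) (τ : Fin (r + 1) → ℂ) (hτ : ∀ j, (τ j).im ≠ 0) :
    G (-z) (fun j => -τ j) = (G z τ)⁻¹ := by
  have hlt : ∀ j, (-τ j).im < 0 ↔ ¬ (τ j).im < 0 := fun j => by
    rw [Complex.neg_im, neg_lt_zero, not_lt]
    exact ⟨le_of_lt, fun h => lt_of_le_of_ne h (hτ j).symm⟩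
  unfold G
  simp only [hlt]
  have hT : (fun j => if ¬ (τ j).im < 0 then - -τ j else -τ j) =
      fun j => if (τ j).im < 0 then -τ j else τ j := by
    funext j
    by_cases h : (τ j).im < 0 <;> simp [h]
  -- Negation exchanges the periods in the two half-planes, so both sides use the same normalized
  -- periods, and the normalized arguments are related by the reflection of `GUpper_reflect`.
  have hz : -z - ∑ j with ¬ (τ j).im < 0, -τ j =
      (∑ j, if (τ j).im < 0 then -τ j else τ j) - (z - ∑ j with (τ j).im < 0, τ j) := by
    rw [Finset.sum_ite]
    simp only [Finset.sum_neg_distrib]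
    ring
  rw [hT, hz, GUpper_reflect, ← zpow_mul, ← zpow_neg]
  congr 1
  have hc := Finset.card_filter_add_card_filter_not (s := (Finset.univ : Finset (Fin (r + 1))))
    (fun j => (τ j).im < 0)
  rw [Finset.card_univ, Fintype.card_fin] at hc
  rw [← pow_add]
  -- The two index sets have cardinalities adding up to `r + 1`, while the reflection contributes
  -- `(-1)^r`; the total exponent is therefore the opposite of the original one.
  have key : (-1 : ℤ) ^ (Finset.univ.filter fun j => (τ j).im < 0).card *
      (-1 : ℤ) ^ (Finset.univ.filter fun j => ¬ (τ j).im < 0).card = (-1) ^ (r + 1) := by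
    rw [← pow_add, hc]
  rcases neg_one_pow_eq_or ℤ (Finset.univ.filter fun j => (τ j).im < 0).card with h | h <;>
  rw [h] at key ⊢ <;> rw [pow_add] <;> rcases neg_one_pow_eq_or ℤ r with h' | h' <;>
  rw [pow_succ, h'] at key <;> rw [h'] <;> linarith

/-- Multiplying the periods by positive integers and adding integers to them. -/
theorem G_eq_prod {r : ℕ} (z : ℂ) (τ : Fin (r + 1) → ℂ) (hτ : ∀ j, (τ j).im ≠ 0)
    (n : Fin (r + 1) → ℕ) (hn : ∀ j, 0 < n j) (m : Fin (r + 1) → ℤ) :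
    G z τ = ∏ k : ∀ j, Fin (n j), G (z + ∑ j, (k j : ℕ) * τ j) (fun j => n j * τ j + m j) := by
  have him : ∀ j, (n j * τ j + m j).im = n j * (τ j).im := fun j => by simp
  have hlt : ∀ j, (n j * τ j + m j).im < 0 ↔ (τ j).im < 0 := fun j => by
    rw [him, mul_neg_iff]
    have : (0 : ℝ) < n j := by exact_mod_cast hn j
    constructor
    · rintro (h | h)
      · exact h.2
      · linarith [h.1]
    · exact fun h => Or.inl ⟨this, h⟩
  unfold G
  simp only [hlt]
  rw [Finset.prod_zpow, GUpper_eq_prod _ _ (fun j => if (τ j).im < 0 then -(n j * τ j + m j)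
    else n j * τ j + m j) _ n hn]
  · congr 1
    -- For a period in the lower half-plane, `k` is matched with `n - 1 - k`: `-τ - (n - 1 - k) τ =
    -- kτ - (nτ + m) + m`, and the integer `m` is invisible to the exponential.
    let e : ∀ j, Equiv.Perm (Fin (n j)) := fun j =>
      if (τ j).im < 0 then Fin.revPerm else Equiv.refl _
    rw [← (Equiv.piCongrRight e).prod_comp]
    refine Finset.prod_congr rfl fun k _ => GUpper_congr ?_ fun j => rfl
    have : z - ∑ j with (τ j).im < 0, τ j +
        ∑ j, (((Equiv.piCongrRight e) k j : ℕ) : ℂ) * (if (τ j).im < 0 then -τ j else τ j) =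
        z + ∑ j, (k j : ℕ) * τ j - ∑ j with (τ j).im < 0, (n j * τ j + m j) +
          ((∑ j with (τ j).im < 0, m j : ℤ) : ℂ) := by
      rw [Finset.sum_filter, Finset.sum_filter, Finset.sum_filter]
      push_cast
      rw [sub_add_eq_add_sub, sub_add_eq_add_sub, add_assoc z, add_sub_assoc,
        add_sub_assoc, ← Finset.sum_add_distrib, ← Finset.sum_sub_distrib,
        ← Finset.sum_sub_distrib]
      congr 1
      refine Finset.sum_congr rfl fun j _ => ?_
      by_cases h : (τ j).im < 0
      · have hk := (k j).2
        have : (((Equiv.piCongrRight e) k j : ℕ) : ℂ) = n j - (k j + 1) := by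
          simp only [Equiv.piCongrRight_apply, Pi.map_apply, e, h, if_true, Fin.revPerm_apply,
            Fin.val_rev]
          rw [Nat.cast_sub hk]
          push_cast
          ring
        rw [this]
        simp only [h, if_true]
        ring
      · simp [h, e]
    rw [this, cexp2pi_add, cexp2pi_int, mul_one]
  · intro j
    split_ifs with h
    · rw [← cexp2pi_nat_mul, neg_add, cexp2pi_add, cexp2pi_neg (m j : ℂ), cexp2pi_int, mul_neg,
        inv_one, mul_one]
    · rw [← cexp2pi_nat_mul, cexp2pi_add, cexp2pi_int, mul_one]
  · intro j
    have := hτ j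
    split_ifs with h
    · simpa using h
    · exact lt_of_le_of_ne (not_lt.1 h) this.symm

/-! ### Primitive vectors -/

section Primitive

theorem IsPrimitive.ne_zero {V : Type*} [AddCommGroup V] {M : Submodule ℤ V} {v : V}
    (hv : IsPrimitive M v) : v ≠ 0 := by
  rintro rfl
  have := hv.2 2 0 M.zero_mem (by simp)
  omega

variable {V : Type*} [AddCommGroup V] [Module ℚ V]

/-- With `t = p / d` in lowest terms and `a p + b d = 1`, one has `v = d (a t v + b v)`, so
primitivity forces `d = 1`. -/
theorem IsPrimitive.exists_int_of_smul_mem {M : Submodule ℤ V} {v : V} (hv : IsPrimitive M v)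
    {t : ℚ} (ht : t • v ∈ M) : ∃ n : ℤ, t = n := by
  have hcop : IsCoprime t.num (t.den : ℤ) := t.isCoprime_num_den
  obtain ⟨a, b, hab⟩ := hcop
  have hden : (t.den : ℚ) ≠ 0 := by exact_mod_cast t.den_ne_zero
  have hw : v = (t.den : ℤ) • (a • (t • v) + b • v) := by
    rw [← Int.cast_smul_eq_zsmul ℚ, ← Int.cast_smul_eq_zsmul ℚ, ← Int.cast_smul_eq_zsmul ℚ,
      smul_smul, ← add_smul, smul_smul]
    have : ((t.den : ℤ) : ℚ) * (a * t + b) = 1 := by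
      have h1 : (a * t.num + b * t.den : ℚ) = 1 := by exact_mod_cast hab
      have h2 : t * t.den = t.num := Rat.mul_den_eq_num t
      push_cast
      linear_combination h1 + a * h2
    rw [this, one_smul]
  have h := hv.2 _ _ (M.add_mem (M.smul_mem a ht) (M.smul_mem b hv.1)) hw
  refine ⟨t.num, ?_⟩
  have hd : t.den = 1 := by
    have := t.den_pos
    omega
  exact (Rat.coe_int_num_of_den_eq_one hd).symm

theorem IsPrimitive.eq_of_smul_eq {M : Submodule ℤ V} {v w : V} (hv : IsPrimitive M v)
    (hw : IsPrimitive M w) {t : ℚ} (ht : 0 < t) (h : w = t • v) : w = v := by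
  obtain ⟨n, rfl⟩ := hv.exists_int_of_smul_mem (h ▸ hw.1)
  have hn : (0 : ℤ) < n := by exact_mod_cast ht
  rw [Int.cast_smul_eq_zsmul] at h
  have : n = 1 := by
    have := hw.2 n v hv.1 h
    omega
  rw [h, this, one_smul]

variable {n : ℕ} (B : Module.Basis (Fin n) ℚ V)

theorem mem_lattice_iff (v : V) : v ∈ lattice B ↔ ∀ i, ∃ k : ℤ, B.repr v i = k := by
  unfold lattice
  rw [B.mem_span_iff_repr_mem ℤ]
  refine forall_congr' fun i => ⟨?_, ?_⟩
  · rintro ⟨k, hk⟩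
    exact ⟨k, by simpa using hk.symm⟩
  · rintro ⟨k, hk⟩
    exact ⟨k, by simpa using hk.symm⟩

theorem exists_nat_smul_mem_lattice (v : V) : ∃ k : ℕ, 0 < k ∧ (k : ℚ) • v ∈ lattice B := by
  refine ⟨∏ i, (B.repr v i).den, Finset.prod_pos fun i _ => (B.repr v i).den_pos, ?_⟩
  rw [mem_lattice_iff]
  intro i
  obtain ⟨m, hm⟩ := Finset.dvd_prod_of_mem (fun i => (B.repr v i).den) (Finset.mem_univ i)
  refine ⟨(B.repr v i).num * m, ?_⟩
  rw [hm, map_smul, Finsupp.smul_apply, smul_eq_mul]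
  push_cast
  linear_combination (m : ℚ) * Rat.mul_den_eq_num (B.repr v i)

/-- Divide the coordinates by their gcd, normalized to be nonnegative. -/
theorem exists_isPrimitive_of_mem_lattice {v : V} (hv : v ∈ lattice B) (h0 : v ≠ 0) :
    ∃ γ, IsPrimitive (lattice B) γ ∧ ∃ s : ℤ, 0 < s ∧ v = s • γ := by
  choose c hc using (mem_lattice_iff B v).1 hv
  have hne : (Finset.univ : Finset (Fin n)).Nonempty := by
    rw [Finset.univ_nonempty_iff]
    by_contra h
    rw [not_nonempty_iff] at h
    exact h0 (B.repr.injective (by ext i; exact h.elim i))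
  obtain ⟨g, hg, hg1⟩ := Finset.extract_gcd c hne
  have hγ : ∀ i, B.repr (∑ i, (g i : ℚ) • B i) i = g i := fun i => by
    rw [B.repr_sum_self]
  have hvγ : v = (Finset.univ.gcd c) • ∑ i, (g i : ℚ) • B i := by
    apply B.repr.injective
    ext i
    rw [map_zsmul, Finsupp.smul_apply, hγ, hc, hg i (Finset.mem_univ _)]
    simp
  refine ⟨∑ i, (g i : ℚ) • B i, ⟨?_, ?_⟩, Finset.univ.gcd c, ?_, hvγ⟩
  · exact (mem_lattice_iff B _).2 fun i => ⟨g i, hγ i⟩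
  · intro m w hw hmw
    choose d hd using (mem_lattice_iff B w).1 hw
    have : m ∣ Finset.univ.gcd g := by
      refine Finset.dvd_gcd fun i _ => ⟨d i, ?_⟩
      have h1 := hγ i
      rw [hmw, map_zsmul, Finsupp.smul_apply, hd, zsmul_eq_mul] at h1
      exact_mod_cast h1.symm
    rw [hg1] at this
    exact Int.isUnit_iff.1 (isUnit_of_dvd_one this)
  · have h1 : Finset.univ.gcd c ≠ 0 := by
      intro h
      rw [h, zero_smul] at hvγ
      exact h0 hvγ
    have h2 : 0 ≤ Finset.univ.gcd c := by
      rw [← Finset.normalize_gcd]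
      exact Int.nonneg_of_normalize_eq_self (normalize_idem _)
    omega

end Primitive

/-! ### Normal vectors -/

section Normal

variable {V : Type*} [AddCommGroup V] [Module ℚ V] {r : ℕ}
  {B : Module.Basis (Fin (r + 2)) ℚ V} {a : Fin (r + 1) → Module.Dual ℚ V} {γ : V}

theorem IsNormalVector.apply_eq_zero (h : IsNormalVector B a γ) (j : Fin (r + 1)) :
    a j γ = 0 := by
  obtain ⟨-, s, hs, hdet⟩ := h
  have h0 := hdet (a j)
  rw [AlternatingMap.map_eq_zero_of_eq _ _ (i := j.castSucc) (j := Fin.last (r + 1)) (by simp)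
    (Fin.castSucc_lt_last j).ne] at h0
  have : (s : ℚ) ≠ 0 := by exact_mod_cast hs.ne'
  simpa [this] using h0

/-- Otherwise the forms would span the dual space, and a vector killed by every form is zero. -/
theorem det_dualBasis_eq_zero {n : ℕ} (B : Module.Basis (Fin n) ℚ V)
    (f : Fin n → Module.Dual ℚ V) {δ : V} (hδ : δ ≠ 0) (hf : ∀ i, f i δ = 0) :
    B.dualBasis.det f = 0 := by
  by_contra h
  have hspan := ((B.dualBasis.is_basis_iff_det (v := f)).2 (isUnit_iff_ne_zero.2 h)).2
  have hV : Module.Finite ℚ V := Module.Finite.of_basis B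
  refine hδ ((Module.forall_dual_apply_eq_zero_iff ℚ δ).1 fun φ => ?_)
  have hφ : φ ∈ Submodule.span ℚ (Set.range f) := hspan ▸ Submodule.mem_top
  induction hφ using Submodule.span_induction with
  | mem x hx =>
    obtain ⟨i, rfl⟩ := hx
    exact hf i
  | zero => simp
  | add x y _ _ hx hy => simp [hx, hy]
  | smul c x _ hx => simp [hx]

/-- The common kernel of the `a_j` is the line through `γ`. This is what makes dual families
comparable and ties `γ` to `h`. -/
theorem IsNormalVector.exists_smul_eq (h : IsNormalVector B a γ) {δ : V}
    (hδ : ∀ j, a j δ = 0) : ∃ t : ℚ, δ = t • γ := by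
  have hV : Module.Finite ℚ V := Module.Finite.of_basis B
  by_cases hδ0 : δ = 0
  · exact ⟨0, by simp [hδ0]⟩
  obtain ⟨hp, s, hs, hdet⟩ := h
  have hs' : (s : ℚ) ≠ 0 := by exact_mod_cast hs.ne'
  obtain ⟨c, hc⟩ : ∃ c : Module.Dual ℚ V, c γ ≠ 0 := by
    by_contra! hcon
    exact hp.ne_zero ((Module.forall_dual_apply_eq_zero_iff ℚ γ).1 hcon)
  refine ⟨c δ / c γ, ?_⟩
  rw [← sub_eq_zero]
  refine (Module.forall_dual_apply_eq_zero_iff ℚ _).1 fun φ => ?_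
  -- The form `c(δ) φ - φ(δ) c` kills `δ`, as the `a_j` do, so its determinant with them vanishes
  -- and it also kills `γ`.
  have h0 : (c δ • φ - φ δ • c) γ = 0 := by
    have h1 := hdet (c δ • φ - φ δ • c)
    rw [det_dualBasis_eq_zero B _ hδ0] at h1
    · simpa [hs'] using h1
    · intro i
      induction i using Fin.lastCases with
      | last => simp [mul_comm]
      | cast i => simpa using hδ i
  simp only [LinearMap.sub_apply, LinearMap.smul_apply, smul_eq_mul] at h0
  rw [map_sub, map_smul, smul_eq_mul]
  field_simp
  linear_combination -h0

theorem IsNormalVector.mem_span (h : IsNormalVector B a γ) {δ : V} (hδL : δ ∈ lattice B)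
    (hδ : ∀ j, a j δ = 0) : δ ∈ Submodule.span ℤ {γ} := by
  obtain ⟨t, rfl⟩ := h.exists_smul_eq hδ
  obtain ⟨n, rfl⟩ := h.1.exists_int_of_smul_mem hδL
  exact Submodule.mem_span_singleton.2 ⟨n, (Int.cast_smul_eq_zsmul ℚ n γ).symm⟩

theorem IsNormalVector.unique {γ' : V} (h : IsNormalVector B a γ) (h' : IsNormalVector B a γ') :
    γ' = γ := by
  have hV : Module.Finite ℚ V := Module.Finite.of_basis B
  obtain ⟨hp, s, hs, hdet⟩ := h
  obtain ⟨hp', s', hs', hdet'⟩ := h'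
  have hs1 : (0 : ℚ) < s := by exact_mod_cast hs
  have hs1' : (0 : ℚ) < s' := by exact_mod_cast hs'
  refine hp.eq_of_smul_eq hp' (div_pos hs1 hs1') ?_
  rw [← sub_eq_zero]
  refine (Module.forall_dual_apply_eq_zero_iff ℚ _).1 fun φ => ?_
  have := (hdet φ).symm.trans (hdet' φ)
  rw [map_sub, map_smul, smul_eq_mul]
  field_simp
  linear_combination -this

theorem IsPositiveDualFamily.linearIndependent {α : Fin (r + 1) → V}
    (hα : IsPositiveDualFamily B a α) : LinearIndependent ℚ a := by
  rw [Fintype.linearIndependent_iff]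
  intro g hg j
  have h := LinearMap.congr_fun hg (α j)
  rw [LinearMap.sum_apply, Finset.sum_eq_single j] at h
  · simpa [(hα j).2.1.ne'] using h
  · intro k _ hk
    simp [(hα j).2.2 k hk]
  · simp

/-- By biduality `c ↦ det(a, c)` is evaluation at some `v`. Integrality of the `a_j` puts `v` in the
lattice, their independence makes it nonzero, and `γ` is the primitive vector on its ray. -/
theorem exists_isNormalVector {α : Fin (r + 1) → V} (ha : ∀ j, a j ∈ dualLattice B)
    (hα : IsPositiveDualFamily B a α) : ∃ γ, IsNormalVector B a γ := by
  have hV : Module.Finite ℚ V := Module.Finite.of_basis B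
  let D : Module.Dual ℚ (Module.Dual ℚ V) :=
    B.dualBasis.det.toMultilinearMap.toLinearMap
      (Fin.snoc (α := fun _ => Module.Dual ℚ V) a 0) (Fin.last (r + 1))
  have hD : ∀ c, D c = B.dualBasis.det (Fin.snoc (α := fun _ => Module.Dual ℚ V) a c) :=
    fun c => by simp [D, Fin.update_snoc_last]
  let v := (Module.evalEquiv ℚ V).symm D
  have hv : ∀ c : Module.Dual ℚ V, c v = D c := fun c =>
    Module.apply_evalEquiv_symm_apply (f := c) (g := D)
  have hvL : v ∈ lattice B := by
    rw [mem_lattice_iff]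
    intro i
    rw [← B.coord_apply, hv, hD, Module.Basis.det_apply]
    have hint : ∀ k l, ∃ m : ℤ, B.dualBasis.toMatrix
        (Fin.snoc (α := fun _ => Module.Dual ℚ V) a (B.coord i)) k l = m := by
      intro k l
      rw [Module.Basis.toMatrix_apply, Module.Basis.dualBasis_repr]
      induction l using Fin.lastCases with
      | last => exact ⟨if k = i then 1 else 0, by simp [Finsupp.single_apply]⟩
      | cast l =>
        rw [Fin.snoc_castSucc]
        exact (mem_dualLattice_iff B _).1 (ha l) _ (Submodule.subset_span ⟨k, rfl⟩)
    choose M hM using hint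
    refine ⟨(Matrix.of M).det, ?_⟩
    rw [Int.cast_det]
    congr 1
    ext k l
    simp [hM]
  have hv0 : v ≠ 0 := by
    have hfin : Module.finrank ℚ (Module.Dual ℚ V) = r + 2 := by
      rw [Module.finrank_eq_card_basis B.dualBasis, Fintype.card_fin]
    obtain ⟨c, hc⟩ : ∃ c, c ∉ Submodule.span ℚ (Set.range a) := by
      by_contra! hcon
      have h1 := finrank_span_eq_card hα.linearIndependent
      rw [(Submodule.eq_top_iff').2 hcon, finrank_top, hfin, Fintype.card_fin] at h1
      omega
    have hli := linearIndependent_finSnoc.2 ⟨hα.linearIndependent, hc⟩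
    have hu := (B.dualBasis.is_basis_iff_det
      (v := Fin.snoc (α := fun _ => Module.Dual ℚ V) a c)).1
      ⟨hli, hli.span_eq_top_of_card_eq_finrank' (by rw [hfin, Fintype.card_fin])⟩
    intro h0
    have := hv c
    rw [h0, map_zero, hD] at this
    exact hu.ne_zero this.symm
  obtain ⟨γ, hγ, s, hs, hsv⟩ := exists_isPrimitive_of_mem_lattice B hvL hv0
  refine ⟨γ, hγ, s, hs, fun c => ?_⟩
  rw [← hD, ← hv, hsv, map_zsmul, zsmul_eq_mul]

theorem normalVector_eq (h : IsNormalVector B a γ) : normalVector B a = γ := by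
  have hex : ∃ γ, IsNormalVector B a γ := ⟨γ, h⟩
  rw [normalVector, dif_pos hex]
  exact h.unique hex.choose_spec

theorem isPositiveDualFamily_dualFamily (h : ∃ α, IsPositiveDualFamily B a α) :
    IsPositiveDualFamily B a (dualFamily B a) := by
  rw [dualFamily, dif_pos h]
  exact h.choose_spec

end Normal

/-! ### Geometric functions as finite products -/

section Geometric

variable {V : Type*} [AddCommGroup V] [Module ℚ V] {r : ℕ}
  {B : Module.Basis (Fin (r + 2)) ℚ V} {a : Fin (r + 1) → Module.Dual ℚ V} {γ : V}
  {α : Fin (r + 1) → V}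

/-- A finite system of representatives of `F(α) / ℤ γ`. -/
structure IsTransversal (B : Module.Basis (Fin (r + 2)) ℚ V) (a : Fin (r + 1) → Module.Dual ℚ V)
    (γ : V) (α : Fin (r + 1) → V) {ι : Type*} (s : Finset ι) (d : ι → V) : Prop where
  mem : ∀ i ∈ s, d i ∈ fundSet B a α
  inj : ∀ i ∈ s, ∀ j ∈ s, d i - d j ∈ Submodule.span ℤ {γ} → i = j
  surj : ∀ δ ∈ fundSet B a α, ∃ i ∈ s, d i - δ ∈ Submodule.span ℤ {γ}

/-- Representatives differing by a multiple of `γ` shift the first variable by an integer, so the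
chosen `Quotient.out` can be replaced by any other system. -/
theorem IsTransversal.geomProduct_eq {ι : Type*} {s : Finset ι} {d : ι → V}
    (hs : IsTransversal B a γ α s d) (w : ℂ) (x : V →ₗ[ℚ] ℂ) (hx : x γ ≠ 0) :
    geomProduct B a γ α w x =
      ∏ i ∈ s, G ((w + x (d i)) / x γ) (fun j => x (α j) / x γ) := by
  have himage : (Submodule.span ℤ {γ}).mkQ '' fundSet B a α =
      (fun i => (Submodule.span ℤ {γ}).mkQ (d i)) '' (s : Set ι) := by
    ext q
    constructor
    · rintro ⟨δ, hδ, rfl⟩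
      obtain ⟨i, hi, h⟩ := hs.surj δ hδ
      exact ⟨i, hi, (Submodule.Quotient.eq _).2 h⟩
    · rintro ⟨i, hi, rfl⟩
      exact ⟨d i, hs.mem i hi, rfl⟩
  have hinj : Set.InjOn (fun i => (Submodule.span ℤ {γ}).mkQ (d i)) (s : Set ι) :=
    fun i hi j hj h => hs.inj i hi j hj ((Submodule.Quotient.eq _).1 h)
  rw [geomProduct, himage, finprod_mem_image hinj, finprod_mem_coe_finset]
  refine Finset.prod_congr rfl fun i _ => ?_
  have hout : Quotient.out ((Submodule.span ℤ {γ}).mkQ (d i)) - d i ∈ Submodule.span ℤ {γ} :=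
    (Submodule.Quotient.eq _).1 (Quotient.out_eq _)
  obtain ⟨m, hm⟩ := Submodule.mem_span_singleton.1 hout
  rw [← eq_sub_iff_add_eq'.1 hm, map_add, map_zsmul, ← add_assoc, add_div,
    zsmul_eq_mul, mul_div_cancel_right₀ _ hx, G_add_int]

/-- Finiteness holds because the values `a_j(δ)` are bounded integers and determine `δ` modulo `ℤ
γ`. -/
theorem exists_isTransversal (hγ : IsNormalVector B a γ) (ha : ∀ j, a j ∈ dualLattice B)
    (α : Fin (r + 1) → V) : ∃ s : Finset V, IsTransversal B a γ α s id := by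
  classical
  have hfin : ((Submodule.span ℤ {γ}).mkQ '' fundSet B a α).Finite := by
    let f : V → Fin (r + 1) → ℤ := fun δ j => ⌊a j δ⌋
    have hf : ∀ δ ∈ lattice B, ∀ j, a j δ = f δ j := fun δ hδ j => by
      obtain ⟨k, hk⟩ := (mem_dualLattice_iff B _).1 (ha j) δ hδ
      simp [f, hk]
    have hfimage : (f '' fundSet B a α).Finite := by
      refine (Set.finite_Icc (0 : Fin (r + 1) → ℤ) (fun j => ⌊a j (α j)⌋)).subset ?_
      rintro _ ⟨δ, hδ, rfl⟩
      exact ⟨fun j => Int.floor_nonneg.2 (hδ.2 j).1,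
        fun j => Int.floor_le_floor (hδ.2 j).2.le⟩
    obtain ⟨t, htF, htf⟩ := Set.exists_subset_bijOn (fundSet B a α) f
    have ht : t.Finite := Set.Finite.of_finite_image (htf.image_eq ▸ hfimage) htf.injOn
    refine (ht.image (Submodule.span ℤ {γ}).mkQ).subset ?_
    rintro _ ⟨δ, hδ, rfl⟩
    obtain ⟨δ', hδ', h⟩ := htf.surjOn ⟨δ, hδ, rfl⟩
    refine ⟨δ', hδ', (Submodule.Quotient.eq _).2 (hγ.mem_span ?_ fun j => ?_)⟩
    · exact Submodule.sub_mem _ (htF hδ').1 hδ.1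
    · rw [map_sub, hf _ (htF hδ').1, hf _ hδ.1, h, sub_self]
  have hout : ∀ δ, Quotient.out ((Submodule.span ℤ {γ}).mkQ δ) - δ ∈ Submodule.span ℤ {γ} :=
    fun δ => (Submodule.Quotient.eq _).1 (Quotient.out_eq _)
  have hF : ∀ δ ∈ fundSet B a α, ∀ δ', δ' - δ ∈ Submodule.span ℤ {γ} →
      δ' ∈ fundSet B a α := by
    intro δ hδ δ' h
    obtain ⟨m, hm⟩ := Submodule.mem_span_singleton.1 h
    have h' : δ' = δ + m • γ := by rw [hm]; abel
    refine ⟨h' ▸ Submodule.add_mem _ hδ.1 (Submodule.smul_mem _ _ hγ.1.1), fun j => ?_⟩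
    rw [h', map_add, map_zsmul, hγ.apply_eq_zero, smul_zero, add_zero]
    exact hδ.2 j
  refine ⟨hfin.toFinset.image Quotient.out, ?_, ?_, ?_⟩
  · intro i hi
    obtain ⟨q, hq, rfl⟩ := Finset.mem_image.1 hi
    obtain ⟨δ, hδ, rfl⟩ := hfin.mem_toFinset.1 hq
    exact hF δ hδ _ (hout δ)
  · intro i hi j hj h
    obtain ⟨q, hq, rfl⟩ := Finset.mem_image.1 hi
    obtain ⟨q', hq', rfl⟩ := Finset.mem_image.1 hj
    have := (Submodule.Quotient.eq (Submodule.span ℤ {γ})).2 h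
    congr 1
    rw [← Quotient.out_eq q, ← Quotient.out_eq q']
    exact this
  · intro δ hδ
    exact ⟨_, Finset.mem_image.2 ⟨_, hfin.mem_toFinset.2 ⟨δ, hδ, rfl⟩, rfl⟩, hout δ⟩

/-- A system of representatives for the family of the `n_j α_j + m_j γ`. -/
theorem IsTransversal.refine {ι : Type*} {s : Finset ι} {d : ι → V} (hγ : IsNormalVector B a γ)
    (hα : IsPositiveDualFamily B a α) (hs : IsTransversal B a γ α s d)
    (n : Fin (r + 1) → ℕ) (m : Fin (r + 1) → ℤ) :
    IsTransversal B a γ (fun j => n j • α j + m j • γ)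
      (s ×ˢ (Finset.univ : Finset (∀ j, Fin (n j))))
      (fun p => d p.1 + ∑ j, (p.2 j : ℕ) • α j) := by
  have hsum : ∀ (k : Fin (r + 1) → ℕ) (j), a j (∑ i, k i • α i) = k j * a j (α j) := by
    intro k j
    rw [map_sum, Finset.sum_eq_single j]
    · rw [map_nsmul, nsmul_eq_mul]
    · intro i _ hi
      rw [map_nsmul, (hα i).2.2 j hi.symm, smul_zero]
    · simp
  have hβ : ∀ j, a j (n j • α j + m j • γ) = n j * a j (α j) := fun j => by
    rw [map_add, map_nsmul, map_zsmul, hγ.apply_eq_zero, smul_zero, add_zero, nsmul_eq_mul]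
  refine ⟨?_, ?_, ?_⟩
  · rintro ⟨i, k⟩ hi
    have hi' := hs.mem i (Finset.mem_product.1 hi).1
    refine ⟨Submodule.add_mem _ hi'.1
      (Submodule.sum_mem _ fun j _ => Submodule.smul_of_tower_mem _ _ (hα j).1), fun j => ?_⟩
    have h1 := hi'.2 j
    have hA := (hα j).2.1
    have hk : ((k j : ℕ) : ℚ) + 1 ≤ n j := by exact_mod_cast (k j).2
    rw [map_add, hsum, hβ]
    constructor
    · have : (0 : ℚ) ≤ (k j : ℕ) * a j (α j) := by positivity
      linarith
    · nlinarith
  · rintro ⟨i, k⟩ hi ⟨i', k'⟩ hi' h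
    have hmi := hs.mem i (Finset.mem_product.1 hi).1
    have hmi' := hs.mem i' (Finset.mem_product.1 hi').1
    have hk : k = k' := by
      funext j
      obtain ⟨l, hl⟩ := Submodule.mem_span_singleton.1 h
      have h0 := congrArg (a j) hl
      rw [map_zsmul, hγ.apply_eq_zero, smul_zero, map_sub, map_add, map_add, hsum, hsum] at h0
      have h1 := hmi.2 j
      have h2 := hmi'.2 j
      have hA := (hα j).2.1
      have h3 : ((k j : ℕ) : ℚ) < (k' j : ℕ) + 1 := by
        by_contra! hcon
        nlinarith
      have h4 : ((k' j : ℕ) : ℚ) < (k j : ℕ) + 1 := by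
        by_contra! hcon
        nlinarith
      have h3' : (k j : ℕ) < (k' j : ℕ) + 1 := by exact_mod_cast h3
      have h4' : (k' j : ℕ) < (k j : ℕ) + 1 := by exact_mod_cast h4
      apply Fin.ext
      omega
    subst hk
    have := hs.inj i (Finset.mem_product.1 hi).1 i' (Finset.mem_product.1 hi').1
      (by simpa using h)
    rw [this]
  · intro δ hδ
    -- The digit `k j` is the integer quotient of `a_j(δ)` by `a_j(α_j)`; it is below `n j` because
    -- `a_j(δ) < n_j a_j(α_j)`.
    have hk : ∀ j, ∃ k : Fin (n j), (k : ℕ) * a j (α j) ≤ a j δ ∧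
        a j δ < ((k : ℕ) + 1) * a j (α j) := by
      intro j
      have hA := (hα j).2.1
      have hδj := hδ.2 j
      rw [hβ] at hδj
      have h1 := Nat.floor_le (div_nonneg hδj.1 hA.le)
      have h2 := Nat.lt_floor_add_one (a j δ / a j (α j))
      rw [le_div_iff₀ hA] at h1
      rw [div_lt_iff₀ hA] at h2
      refine ⟨⟨⌊a j δ / a j (α j)⌋₊, ?_⟩, h1, h2⟩
      have : (⌊a j δ / a j (α j)⌋₊ : ℚ) < n j := by
        by_contra! hcon
        nlinarith
      exact_mod_cast this
    choose k hk1 hk2 using hk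
    obtain ⟨i, hi, h⟩ := hs.surj (δ - ∑ j, (k j : ℕ) • α j) ⟨Submodule.sub_mem _ hδ.1
      (Submodule.sum_mem _ fun j _ => Submodule.smul_of_tower_mem _ _ (hα j).1), fun j => by
        rw [map_sub, hsum (fun j => k j)]
        have := hk1 j
        have := hk2 j
        constructor <;> linarith⟩
    refine ⟨(i, k), Finset.mem_product.2 ⟨hi, Finset.mem_univ _⟩, ?_⟩
    convert h using 1
    abel

theorem geomProduct_refine (hγ : IsNormalVector B a γ) (ha : ∀ j, a j ∈ dualLattice B)
    (hα : IsPositiveDualFamily B a α) (n : Fin (r + 1) → ℕ) (hn : ∀ j, 0 < n j)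
    (m : Fin (r + 1) → ℤ) (w : ℂ) (x : V →ₗ[ℚ] ℂ) (hx : ∀ j, (x (α j) / x γ).im ≠ 0) :
    geomProduct B a γ (fun j => n j • α j + m j • γ) w x = geomProduct B a γ α w x := by
  have hx0 : x γ ≠ 0 := fun h => hx 0 (by simp [h])
  obtain ⟨s, hs⟩ := exists_isTransversal hγ ha α
  rw [hs.geomProduct_eq w x hx0, (hs.refine hγ hα n m).geomProduct_eq w x hx0,
    Finset.prod_product]
  refine Finset.prod_congr rfl fun δ _ => ?_
  rw [G_eq_prod _ _ hx n hn m]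
  refine Finset.prod_congr rfl fun k _ => ?_
  congr 1
  · rw [map_add, map_sum, ← add_assoc, add_div _ (∑ j, _), Finset.sum_div]
    congr 1
    refine Finset.sum_congr rfl fun j _ => ?_
    rw [map_nsmul, nsmul_eq_mul, mul_div_assoc]
  · funext j
    rw [map_add, map_nsmul, map_zsmul, nsmul_eq_mul, zsmul_eq_mul, add_div, mul_div_assoc,
      mul_div_cancel_right₀ _ hx0]

/-- The geometric functions do not depend on the choice of a positive dual family. -/
theorem geomProduct_eq_of_isPositiveDualFamily (hγ : IsNormalVector B a γ)
    (ha : ∀ j, a j ∈ dualLattice B) {α' : Fin (r + 1) → V}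
    (hα : IsPositiveDualFamily B a α) (hα' : IsPositiveDualFamily B a α') (w : ℂ)
    (x : V →ₗ[ℚ] ℂ) (hx : ∀ j, (x (α j) / x γ).im ≠ 0) (hx' : ∀ j, (x (α' j) / x γ).im ≠ 0) :
    geomProduct B a γ α w x = geomProduct B a γ α' w x := by
  have key : ∀ j, ∃ (n n' : ℕ) (m : ℤ), 0 < n ∧ 0 < n' ∧ n • α j + m • γ = n' • α' j := by
    intro j
    have hA := (hα j).2.1
    have hA' := (hα' j).2.1
    -- With `c` the ratio of the diagonal values, `α'_j - c α_j` is killed by every form, hence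
    -- equals `t γ`. Multiplying by the denominators of `c` and `t` gives the integers sought.
    set c : ℚ := a j (α' j) / a j (α j) with hc
    have hcpos : 0 < c := div_pos hA' hA
    obtain ⟨t, ht⟩ := hγ.exists_smul_eq (δ := α' j - c • α j) fun k => by
      rw [map_sub, map_smul, smul_eq_mul]
      by_cases hk : k = j
      · subst hk
        rw [hc]
        field_simp
        ring
      · rw [(hα j).2.2 k hk, (hα' j).2.2 k hk, mul_zero, sub_zero]
    refine ⟨c.num.toNat * t.den, c.den * t.den, t.num * c.den,
      mul_pos (by have := Rat.num_pos.2 hcpos; omega) t.den_pos,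
      mul_pos c.den_pos t.den_pos, ?_⟩
    have h1 : ((c.num.toNat : ℕ) : ℚ) = c * c.den := by
      rw [Rat.mul_den_eq_num]
      have := Int.toNat_of_nonneg (Rat.num_nonneg.2 hcpos.le)
      exact_mod_cast this
    have h2 : (t.num : ℚ) = t * t.den := (Rat.mul_den_eq_num t).symm
    rw [sub_eq_iff_eq_add] at ht
    rw [ht, ← Nat.cast_smul_eq_nsmul ℚ, ← Nat.cast_smul_eq_nsmul ℚ, ← Int.cast_smul_eq_zsmul ℚ,
      smul_add, smul_smul, smul_smul, add_comm]
    push_cast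
    rw [h1, h2]
    congr 2 <;> ring
  choose n n' m hn hn' h using key
  rw [← geomProduct_refine hγ ha hα n hn m w x hx,
    ← geomProduct_refine hγ ha hα' n' hn' 0 w x hx']
  congr 1
  funext j
  simp [h j]

theorem geomG_eq_geomProduct (hγ : IsNormalVector B a γ) (ha : ∀ j, a j ∈ dualLattice B)
    (hα : IsPositiveDualFamily B a α) (w : ℂ) (x : V →ₗ[ℚ] ℂ)
    (hx : ∀ α', IsPositiveDualFamily B a α' → ∀ j, (x (α' j) / x γ).im ≠ 0) :
    geomG B a w x = geomProduct B a γ α w x := by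
  have hα' := isPositiveDualFamily_dualFamily ⟨α, hα⟩
  rw [geomG, normalVector_eq hγ]
  exact geomProduct_eq_of_isPositiveDualFamily hγ ha hα' hα w x (hx _ hα') (hx _ hα)

theorem geomG_eq_one (h : ¬ ∃ α, IsPositiveDualFamily B a α) (w : ℂ) (x : V →ₗ[ℚ] ℂ) :
    geomG B a w x = 1 := by
  -- Without a dual family the default is `0`, for which the condition `0 ≤ a_0(δ) < 0` is void: the
  -- product is empty.
  have : fundSet B a (0 : Fin (r + 1) → V) = ∅ := by
    rw [Set.eq_empty_iff_forall_notMem]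
    rintro δ ⟨-, hδ⟩
    have := hδ 0
    rw [Pi.zero_apply, map_zero] at this
    exact absurd this.2 (not_lt.2 this.1)
  rw [geomG, dualFamily, dif_neg h, geomProduct, this]
  simp

/-! ### Action of the automorphisms of the lattice -/

theorem IsPositiveDualFamily.map (hα : IsPositiveDualFamily B a α) (e : V ≃ₗ[ℚ] V)
    (he : ∀ v ∈ lattice B, e v ∈ lattice B) :
    IsPositiveDualFamily B (fun j => (a j).comp (e.symm : V →ₗ[ℚ] V)) (fun j => e (α j)) := by
  refine fun j => ⟨he _ (hα j).1, ?_, fun k hk => ?_⟩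
  · simpa using (hα j).2.1
  · simpa using (hα j).2.2 k hk

theorem IsPositiveDualFamily.of_map (e : V ≃ₗ[ℚ] V)
    (he : ∀ v, e v ∈ lattice B → v ∈ lattice B)
    (hα : IsPositiveDualFamily B (fun j => (a j).comp (e.symm : V →ₗ[ℚ] V)) α) :
    IsPositiveDualFamily B a (fun j => e.symm (α j)) :=
  fun j => ⟨he _ (by simpa using (hα j).1), (hα j).2.1, (hα j).2.2⟩

theorem IsPrimitive.units_smul_map {M : Submodule ℤ V} {v : V} (hv : IsPrimitive M v) (η : ℤˣ)
    (e : V ≃ₗ[ℚ] V) (he : ∀ v, e v ∈ M ↔ v ∈ M) : IsPrimitive M ((η : ℤ) • e v) := by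
  refine ⟨M.smul_mem _ ((he v).2 hv.1), fun n w hw h => ?_⟩
  refine hv.2 n ((η : ℤ) • e.symm w) (M.smul_mem _ ((he _).1 (by simpa using hw))) ?_
  apply e.injective
  have h1 := congrArg (fun u => (η : ℤ) • u) h
  simp only [smul_smul, ← Units.val_mul, Int.units_mul_self, Units.val_one, one_smul] at h1
  rw [h1, map_zsmul, map_zsmul, e.apply_symm_apply, smul_smul, mul_comm]

/-- Composing all the forms with `e⁻¹` multiplies their determinant by `η`, which the sign in front
of `e γ` absorbs so that `s` stays positive. -/
theorem IsNormalVector.map (hγ : IsNormalVector B a γ) (e : V ≃ₗ[ℚ] V)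
    (he : ∀ v, e v ∈ lattice B ↔ v ∈ lattice B) (η : ℤˣ)
    (hdet : LinearMap.det (e.symm : V →ₗ[ℚ] V) = ((η : ℤ) : ℚ)) :
    IsNormalVector B (fun j => (a j).comp (e.symm : V →ₗ[ℚ] V)) ((η : ℤ) • e γ) := by
  have hV : Module.Finite ℚ V := Module.Finite.of_basis B
  obtain ⟨hp, s, hs, h⟩ := hγ
  refine ⟨hp.units_smul_map η e he, s, hs, fun c => ?_⟩
  have hsnoc : Fin.snoc (α := fun _ => Module.Dual ℚ V)
      (fun j => (a j).comp (e.symm : V →ₗ[ℚ] V)) c =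
      (e.symm : V →ₗ[ℚ] V).dualMap ∘
        Fin.snoc (α := fun _ => Module.Dual ℚ V) a (c.comp (e : V →ₗ[ℚ] V)) := by
    funext i
    induction i using Fin.lastCases with
    | last => ext v; simp
    | cast i => ext v; simp
  rw [hsnoc, Module.Basis.det_comp, LinearMap.det_dualMap, hdet, h, map_zsmul, zsmul_eq_mul]
  simp only [LinearMap.comp_apply, LinearEquiv.coe_coe]
  ring

theorem IsTransversal.map {s : Finset V} (hs : IsTransversal B a γ α s id) (e : V ≃ₗ[ℚ] V)
    (he : ∀ v, e v ∈ lattice B ↔ v ∈ lattice B) (η : ℤˣ) :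
    IsTransversal B (fun j => (a j).comp (e.symm : V →ₗ[ℚ] V)) ((η : ℤ) • e γ)
      (fun j => e (α j)) s e := by
  have hspan : ∀ v, e v ∈ Submodule.span ℤ {(η : ℤ) • e γ} → v ∈ Submodule.span ℤ {γ} := by
    intro v hv
    obtain ⟨n, hn⟩ := Submodule.mem_span_singleton.1 hv
    refine Submodule.mem_span_singleton.2 ⟨n * η, e.injective ?_⟩
    rw [← hn, map_zsmul, smul_smul]
  refine ⟨fun i hi => ?_, fun i hi j hj h => ?_, fun δ hδ => ?_⟩
  · refine ⟨(he _).2 (hs.mem i hi).1, fun j => ?_⟩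
    simpa using (hs.mem i hi).2 j
  · exact hs.inj i hi j hj (hspan _ (by simpa using h))
  · obtain ⟨i, hi, h⟩ := hs.surj (e.symm δ)
      ⟨(he _).1 (by simpa using hδ.1), fun j => by simpa using hδ.2 j⟩
    refine ⟨i, hi, ?_⟩
    obtain ⟨n, hn⟩ := Submodule.mem_span_singleton.1 h
    refine Submodule.mem_span_singleton.2 ⟨n * η, ?_⟩
    rw [smul_smul, mul_assoc, ← Units.val_mul, Int.units_mul_self, Units.val_one, mul_one,
      ← map_zsmul, hn]
    simp

/-- The effect on the geometric functions of an automorphism of the lattice with determinant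
`η = ±1` which multiplies the values of `x` by a constant. -/
theorem geomG_comp_symm (ha : ∀ j, a j ∈ dualLattice B) (e : V ≃ₗ[ℚ] V)
    (he : ∀ v, e v ∈ lattice B ↔ v ∈ lattice B) (η : ℤˣ)
    (hdet : LinearMap.det (e.symm : V →ₗ[ℚ] V) = ((η : ℤ) : ℚ)) (x : V →ₗ[ℚ] ℂ) {c : ℂ}
    (hc : c ≠ 0) (hxe : ∀ v, x (e v) = c * x v) (w : ℂ)
    (hx : ∀ γ α, IsNormalVector B a γ → IsPositiveDualFamily B a α →
      ∀ j, (x (α j) / x γ).im ≠ 0) :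
    geomG B (fun j => (a j).comp (e.symm : V →ₗ[ℚ] V)) (c * w) x = geomG B a w x ^ (η : ℤ) := by
  by_cases hex : ∃ α, IsPositiveDualFamily B a α
  swap
  · rw [geomG_eq_one hex, geomG_eq_one, one_zpow]
    rintro ⟨α, hα⟩
    exact hex ⟨_, hα.of_map e fun v => (he v).1⟩
  obtain ⟨α, hα⟩ := hex
  obtain ⟨γ, hγ⟩ := exists_isNormalVector ha hα
  have hx0 : x γ ≠ 0 := fun h => hx γ α hγ hα 0 (by simp [h])
  have hη : ((η : ℤ) : ℂ) ≠ 0 := by exact_mod_cast η.ne_zero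
  have hηinv : ((η : ℤ) : ℂ)⁻¹ = (η : ℤ) := by
    rcases Int.units_eq_one_or η with rfl | rfl <;> simp
  -- The constant `c` cancels and only the sign survives, since `η⁻¹ = η`.
  have hquot : ∀ z : ℂ, c * z / x ((η : ℤ) • e γ) = (η : ℤ) * (z / x γ) := fun z => by
    rw [map_zsmul, hxe, zsmul_eq_mul, mul_left_comm, mul_div_mul_left _ _ hc, div_mul_eq_div_div,
      div_right_comm, div_eq_mul_inv (z / x γ), hηinv, mul_comm]
  have ha' : ∀ j, (a j).comp (e.symm : V →ₗ[ℚ] V) ∈ dualLattice B := fun j =>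
    (mem_dualLattice_iff B _).2 fun v hv =>
      (mem_dualLattice_iff B _).1 (ha j) _ ((he _).1 (by simpa using hv))
  have hx' : ∀ α', IsPositiveDualFamily B (fun j => (a j).comp (e.symm : V →ₗ[ℚ] V)) α' →
      ∀ j, (x (α' j) / x ((η : ℤ) • e γ)).im ≠ 0 := by
    intro α' hα' j
    have h := hx γ _ hγ (hα'.of_map e fun v => (he v).1) j
    rw [← e.apply_symm_apply (α' j), hxe, hquot]
    rcases Int.units_eq_one_or η with rfl | rfl <;> simpa using h
  obtain ⟨s, hs⟩ := exists_isTransversal hγ ha α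
  rw [geomG_eq_geomProduct (hγ.map e he η hdet) ha' (hα.map e fun v => (he v).2) _ _ hx',
    geomG_eq_geomProduct hγ ha hα w x (fun α' hα' => hx γ α' hγ hα'),
    hs.geomProduct_eq w x hx0, (hs.map e he η).geomProduct_eq, ← Finset.prod_zpow]
  · refine Finset.prod_congr rfl fun δ _ => ?_
    simp only [hxe, hquot, ← mul_add, id]
    rcases Int.units_eq_one_or η with rfl | rfl
    · simp
    · simpa using G_neg _ _ (hx γ α hγ hα)
  · rw [map_zsmul, hxe, zsmul_eq_mul]
    exact mul_ne_zero hη (mul_ne_zero hc hx0)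

end Geometric

/-! ### Action of the units on the linear forms -/

section Arithmetic

open NumberField

variable {K : Type*} [Field K]

theorem units_coe_ne_zero (ε : (𝓞 K)ˣ) : ((ε : 𝓞 K) : K) ≠ 0 :=
  RingOfIntegers.coe_ne_zero_iff.2 ε.ne_zero

theorem units_mul_mem_iff (I : FractionalIdeal (𝓞 K)⁰ K) (ε : (𝓞 K)ˣ) (x : K) :
    ((ε : 𝓞 K) : K) * x ∈ I ↔ x ∈ I := by
  have key : ∀ (η : (𝓞 K)ˣ) (y : K), y ∈ I → ((η : 𝓞 K) : K) * y ∈ I := fun η y hy =>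
    Submodule.smul_mem (I : Submodule (𝓞 K) K) (η : 𝓞 K) hy
  refine ⟨fun h => ?_, key ε x⟩
  have h1 := key ε⁻¹ _ h
  rwa [← mul_assoc, ← map_mul, Units.inv_mul, map_one, one_mul] at h1

theorem exists_unitFamily_eq {r : ℕ} (u : Fin r → (𝓞 K)ˣ) (j : Fin (r + 1)) :
    ∃ ε : (𝓞 K)ˣ, unitFamily u j = ((ε : 𝓞 K) : K) := by
  induction j using Fin.cases with
  | zero => exact ⟨1, by simp [unitFamily]⟩
  | succ j => exact ⟨u j, by simp [unitFamily]⟩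

variable [NumberField K]

/-- Multiplication by a unit. -/
def unitMulEquiv (ε : (𝓞 K)ˣ) : K ≃ₗ[ℚ] K where
  __ := LinearMap.mulLeft ℚ ((ε : 𝓞 K) : K)
  invFun x := ((ε : 𝓞 K) : K)⁻¹ * x
  left_inv x := inv_mul_cancel_left₀ (units_coe_ne_zero ε) x
  right_inv x := mul_inv_cancel_left₀ (units_coe_ne_zero ε) x

@[simp]
theorem unitMulEquiv_apply (ε : (𝓞 K)ˣ) (x : K) : unitMulEquiv ε x = ((ε : 𝓞 K) : K) * x := rfl

@[simp]
theorem unitMulEquiv_symm_apply (ε : (𝓞 K)ˣ) (x : K) :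
    (unitMulEquiv ε).symm x = ((ε : 𝓞 K) : K)⁻¹ * x := rfl

theorem det_unitMulEquiv (ε : (𝓞 K)ˣ) : LinearMap.det (unitMulEquiv ε : K →ₗ[ℚ] K) =
    ((Units.map (Algebra.norm ℤ) ε : ℤˣ) : ℤ) := by
  rw [Units.coe_map, Algebra.coe_norm_int, Algebra.norm_apply]
  rfl

theorem det_unitMulEquiv_symm (ε : (𝓞 K)ˣ) :
    LinearMap.det ((unitMulEquiv ε).symm : K →ₗ[ℚ] K) =
      ((Units.map (Algebra.norm ℤ) ε : ℤˣ) : ℤ) := by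
  have h := (unitMulEquiv ε).det_symm_mul_det
  rw [det_unitMulEquiv] at h
  rcases Int.units_eq_one_or (Units.map (Algebra.norm ℤ) ε) with h' | h' <;> rw [h'] at h ⊢ <;>
    push_cast [Units.val_neg, Units.val_one] at h ⊢ <;> linarith

variable {r : ℕ} {B : Module.Basis (Fin (r + 2)) ℚ K} {u : Fin r → (𝓞 K)ˣ} {h : K}

theorem IsLinearForm.unique {a a' : Module.Dual ℚ K} (ha : IsLinearForm B u h a)
    (ha' : IsLinearForm B u h a') : a' = a := by
  obtain ⟨hp, n, hn, hdet⟩ := ha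
  obtain ⟨hp', n', hn', hdet'⟩ := ha'
  have h1 : (0 : ℚ) < n := by exact_mod_cast hn
  have h1' : (0 : ℚ) < n' := by exact_mod_cast hn'
  refine hp.eq_of_smul_eq hp' (div_pos h1 h1') ?_
  ext v
  have := (hdet v).trans (hdet' v).symm
  rw [LinearMap.smul_apply, smul_eq_mul]
  field_simp
  linear_combination -this

theorem linearForm_eq {a : Module.Dual ℚ K} (ha : IsLinearForm B u h a) :
    linearForm B u h = a := by
  have hex : ∃ a, IsLinearForm B u h a := ⟨a, ha⟩
  rw [linearForm, dif_pos hex]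
  exact ha.unique hex.choose_spec

theorem IsLinearForm.units_mul {a : Module.Dual ℚ K} (ha : IsLinearForm B u h a) (ε : (𝓞 K)ˣ)
    (hε : ∀ v, ((ε : 𝓞 K) : K) * v ∈ lattice B ↔ v ∈ lattice B) :
    IsLinearForm B u (((ε : 𝓞 K) : K) * h) (((Units.map (Algebra.norm ℤ) ε : ℤˣ) : ℤ) •
      a.comp ((unitMulEquiv ε).symm : K →ₗ[ℚ] K)) := by
  obtain ⟨hp, n, hn, hdet⟩ := ha
  have hL : ∀ f : Module.Dual ℚ K,
      (unitMulEquiv ε).symm.dualMap f ∈ dualLattice B ↔ f ∈ dualLattice B := by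
    intro f
    simp only [mem_dualLattice_iff, LinearEquiv.dualMap_apply]
    constructor
    · intro H v hv
      have := H (unitMulEquiv ε v) ((hε v).2 hv)
      rwa [LinearEquiv.symm_apply_apply] at this
    · intro H v hv
      refine H _ ((hε _).1 ?_)
      rwa [unitMulEquiv_symm_apply, mul_inv_cancel_left₀ (units_coe_ne_zero ε)]
  refine ⟨hp.units_smul_map _ _ hL, n, hn, fun v => ?_⟩
  have hsnoc : Fin.snoc (α := fun _ => K)
      (fun j => unitFamily u j * (((ε : 𝓞 K) : K) * h)) v = (unitMulEquiv ε : K →ₗ[ℚ] K) ∘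
        Fin.snoc (α := fun _ => K) (fun j => unitFamily u j * h) ((unitMulEquiv ε).symm v) := by
    funext i
    induction i using Fin.lastCases with
    | last =>
      simp only [Fin.snoc_last, Function.comp_apply, LinearEquiv.coe_coe,
        LinearEquiv.apply_symm_apply]
    | cast i =>
      simp only [Fin.snoc_castSucc, Function.comp_apply, LinearEquiv.coe_coe, unitMulEquiv_apply]
      ring
  rw [hsnoc, Module.Basis.det_comp, det_unitMulEquiv, ← hdet, LinearMap.smul_apply,
    zsmul_eq_mul, LinearMap.comp_apply, LinearEquiv.coe_coe]
  ring

/-- If no form exists for `h`, applying `ε⁻¹` shows that none exists for `εh`, and both sides take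
the default value `0`. -/
theorem linearForm_units_mul (ε : (𝓞 K)ˣ)
    (hε : ∀ v, ((ε : 𝓞 K) : K) * v ∈ lattice B ↔ v ∈ lattice B) :
    linearForm B u (((ε : 𝓞 K) : K) * h) = ((Units.map (Algebra.norm ℤ) ε : ℤˣ) : ℤ) •
      (linearForm B u h).comp ((unitMulEquiv ε).symm : K →ₗ[ℚ] K) := by
  by_cases hex : ∃ a, IsLinearForm B u h a
  · obtain ⟨a, ha⟩ := hex
    rw [linearForm_eq ha, linearForm_eq (ha.units_mul ε hε)]
  · have hinv : ∀ v, ((ε⁻¹ : (𝓞 K)ˣ) : K) * (((ε : 𝓞 K) : K) * v) = v := fun v => by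
      rw [← mul_assoc, ← map_mul, Units.inv_mul, map_one, one_mul]
    have hinv' : ∀ v, ((ε : 𝓞 K) : K) * (((ε⁻¹ : (𝓞 K)ˣ) : K) * v) = v := fun v => by
      rw [← mul_assoc, ← map_mul, Units.mul_inv, map_one, one_mul]
    have hex' : ¬ ∃ a, IsLinearForm B u (((ε : 𝓞 K) : K) * h) a := by
      rintro ⟨a, ha⟩
      have := ha.units_mul ε⁻¹ fun v => by rw [← hε, hinv']
      rw [hinv] at this
      exact hex ⟨_, this⟩
    rw [linearForm, dif_neg hex', linearForm, dif_neg hex, LinearMap.zero_comp, smul_zero]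

theorem formFamily_units_mul (ε : (𝓞 K)ˣ)
    (hε : ∀ v, ((ε : 𝓞 K) : K) * v ∈ lattice B ↔ v ∈ lattice B) (j : Fin (r + 1)) :
    formFamily B u (((ε : 𝓞 K) : K) * h) j = ((Units.map (Algebra.norm ℤ) ε : ℤˣ) : ℤ) •
      (formFamily B u h j).comp ((unitMulEquiv ε).symm : K →ₗ[ℚ] K) := by
  rw [formFamily, linearForm_units_mul ε hε]
  ext v
  simp only [formFamily, LinearMap.comp_apply, LinearMap.smul_apply, LinearMap.mulLeft_apply,
    LinearEquiv.coe_coe, unitMulEquiv_symm_apply]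
  rw [mul_left_comm]

/-- The determinant defining `a(u_j h)` has the column `u_j h` twice. -/
theorem formFamily_apply_self (j : Fin (r + 1)) : formFamily B u h j h = 0 := by
  by_cases hex : ∃ a, IsLinearForm B u h a
  · obtain ⟨a, ha⟩ := hex
    rw [formFamily, linearForm_eq ha, LinearMap.comp_apply, LinearMap.mulLeft_apply]
    obtain ⟨-, n, hn, hdet⟩ := ha
    have h0 := hdet (unitFamily u j * h)
    rw [AlternatingMap.map_eq_zero_of_eq _ _ (i := j.castSucc) (j := Fin.last (r + 1)) (by simp)
      (Fin.castSucc_lt_last j).ne] at h0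
    have : (n : ℚ) ≠ 0 := by exact_mod_cast hn.ne'
    simpa [this] using h0
  · rw [formFamily, linearForm, dif_neg hex, LinearMap.zero_comp, LinearMap.zero_apply]

theorem linearForm_mem_dualLattice : linearForm B u h ∈ dualLattice B := by
  by_cases hex : ∃ a, IsLinearForm B u h a
  · obtain ⟨a, ha⟩ := hex
    rw [linearForm_eq ha]
    exact ha.1.1
  · rw [linearForm, dif_neg hex]
    exact Submodule.zero_mem _

theorem linearForm_apply_self : linearForm B u h h = 0 := by
  simpa [formFamily, unitFamily] using formFamily_apply_self (B := B) (u := u) (h := h) 0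

theorem formFamily_mem_dualLattice {I : FractionalIdeal (𝓞 K)⁰ K} (hB : IsIntegralBasisOf B I)
    (j : Fin (r + 1)) : formFamily B u h j ∈ dualLattice B := by
  obtain ⟨ε, hε⟩ := exists_unitFamily_eq u j
  refine (mem_dualLattice_iff B _).2 fun v hv => ?_
  rw [formFamily, LinearMap.comp_apply, LinearMap.mulLeft_apply, hε]
  refine (mem_dualLattice_iff B _).1 linearForm_mem_dualLattice _ ?_
  rwa [hB, units_mul_mem_iff, ← hB]

/-- The forms attached to `h` and a lattice `J` are integral on every larger lattice `I` such that
`I / J` is generated by the class of a rational multiple of `h`. -/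
theorem formFamily_mem_dualLattice_of_generatesQuotient {I J : FractionalIdeal (𝓞 K)⁰ K}
    (hB : IsIntegralBasisOf B J) {B' : Module.Basis (Fin (r + 2)) ℚ K}
    (hB' : IsIntegralBasisOf B' I) {N : ℕ} (hgen : GeneratesQuotient I J (h / (N : K)))
    (j : Fin (r + 1)) : formFamily B u h j ∈ dualLattice B' := by
  obtain ⟨ε, hε⟩ := exists_unitFamily_eq u j
  refine (mem_dualLattice_iff B' _).2 fun v hv => ?_
  rw [formFamily, LinearMap.comp_apply, LinearMap.mulLeft_apply, hε]
  -- Modulo `J`, the vector is a multiple of `h / N`, on which the form vanishes; its value is thus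
  -- that of a vector of `J`.
  obtain ⟨n, hn⟩ := hgen.2 (((ε : 𝓞 K) : K) * v) ((units_mul_mem_iff I ε v).2 ((hB' v).1 hv))
  obtain ⟨k, hk⟩ := (mem_dualLattice_iff B _).1
    (linearForm_mem_dualLattice (B := B) (u := u) (h := h)) _ ((hB _).2 hn)
  refine ⟨k, ?_⟩
  have h0 : linearForm B u h (h / (N : K)) = 0 := by
    have : h / (N : K) = (N : ℚ)⁻¹ • h := by
      rw [Algebra.smul_def, map_inv₀, map_natCast, div_eq_inv_mul]
    rw [this, map_smul, linearForm_apply_self, smul_zero]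
  rwa [map_sub, map_zsmul, h0, smul_zero, sub_zero] at hk

/-- The periods of the functions attached to `h` are not real. -/
theorem im_div_ne_zero_of_isNormalVector (σ : K →+* ℂ)
    (h_nonreal : ∀ α, IsPositiveDualFamily B (formFamily B u h) α →
      ∀ j, (σ (α j / h)).im ≠ 0) (B' : Module.Basis (Fin (r + 2)) ℚ K) (μ : ℤˣ) {γ : K}
    {α : Fin (r + 1) → K}
    (hγ : IsNormalVector B' (fun j => (μ : ℤ) • formFamily B u h j) γ)
    (hα : IsPositiveDualFamily B' (fun j => (μ : ℤ) • formFamily B u h j) α) (j : Fin (r + 1)) :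
    (σ (α j) / σ γ).im ≠ 0 := by
  have hμ : ((μ : ℤ) : ℚ) ≠ 0 := by exact_mod_cast μ.ne_zero
  choose k hk0 hk using fun j => exists_nat_smul_mem_lattice B (α j)
  -- The factor `k j` brings `α_j` from the lattice of `B'` into that of `B`, and `μ` undoes the
  -- sign of the forms.
  have hα' : IsPositiveDualFamily B (formFamily B u h)
      (fun j => (μ : ℤ) • ((k j : ℚ) • α j)) := by
    refine fun j => ⟨Submodule.smul_mem _ _ (hk j), ?_, fun l hl => ?_⟩
    · have h1 := (hα j).2.1
      have h2 : (0 : ℚ) < k j := by exact_mod_cast hk0 j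
      rw [LinearMap.smul_apply] at h1
      rw [map_zsmul, map_smul, smul_comm]
      exact smul_pos h2 h1
    · have h1 := (hα j).2.2 l hl
      rw [LinearMap.smul_apply] at h1
      rw [map_zsmul, map_smul, smul_comm, h1, smul_zero]
  have him := h_nonreal _ hα'
  have hh : h ≠ 0 := by
    rintro rfl
    exact him 0 (by simp)
  -- All the forms kill `h`, so `h` is a rational multiple of `γ`; dividing by `h` or by `γ` thus
  -- changes the period only by a nonzero rational factor.
  obtain ⟨t, ht⟩ := hγ.exists_smul_eq (δ := h) fun j => by
    rw [LinearMap.smul_apply, formFamily_apply_self, smul_zero]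
  have ht0 : t ≠ 0 := by
    rintro rfl
    exact hh (by simpa using ht)
  intro h0
  refine him j ?_
  have hσ : σ ((μ : ℤ) • ((k j : ℚ) • α j) / h) =
      (((μ : ℤ) * k j / t : ℝ) : ℂ) * (σ (α j) / σ γ) := by
    rw [ht, zsmul_eq_mul, Algebra.smul_def, Algebra.smul_def, eq_ratCast, eq_ratCast]
    simp only [map_div₀, map_mul, map_intCast, map_ratCast]
    push_cast
    ring
  rw [hσ, Complex.im_ofReal_mul, h0, mul_zero]

/-- The effect of a unit on the arithmetic geometric functions attached to a lattice. -/
theorem geomG_formFamily_units_mul (σ : K →+* ℂ)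
    (h_nonreal : ∀ α, IsPositiveDualFamily B (formFamily B u h) α →
      ∀ j, (σ (α j / h)).im ≠ 0) {I J : FractionalIdeal (𝓞 K)⁰ K} (hB : IsIntegralBasisOf B J)
    {B' : Module.Basis (Fin (r + 2)) ℚ K} (hB' : IsIntegralBasisOf B' I)
    (hint : ∀ j, formFamily B u h j ∈ dualLattice B') (μ : ℤˣ) (ε : (𝓞 K)ˣ) (q : K) :
    geomG B' (fun j => (μ : ℤ) • formFamily B u (((ε : 𝓞 K) : K) * h) j)
        (σ (((ε : 𝓞 K) : K) * h / q)) σ.toRatAlgHom.toLinearMap =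
      geomG B' (fun j => ((μ * Units.map (Algebra.norm ℤ) ε : ℤˣ) : ℤ) • formFamily B u h j)
        (σ (h / q)) σ.toRatAlgHom.toLinearMap ^
          ((Units.map (Algebra.norm ℤ) ε : ℤˣ) : ℤ) := by
  have hεB : ∀ v, ((ε : 𝓞 K) : K) * v ∈ lattice B ↔ v ∈ lattice B := fun v => by
    rw [hB, hB, units_mul_mem_iff]
  have hforms : (fun j => (μ : ℤ) • formFamily B u (((ε : 𝓞 K) : K) * h) j) = fun j =>
      (((μ * Units.map (Algebra.norm ℤ) ε : ℤˣ) : ℤ) • formFamily B u h j).comp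
        ((unitMulEquiv ε).symm : K →ₗ[ℚ] K) := by
    funext j
    rw [formFamily_units_mul ε hεB, smul_smul, Units.val_mul, LinearMap.smul_comp]
  rw [hforms, mul_div_assoc, map_mul]
  refine geomG_comp_symm (fun j => Submodule.smul_mem _ _ (hint j)) (unitMulEquiv ε)
    (fun v => ?_) _ (det_unitMulEquiv_symm ε) _ ?_ (fun v => ?_) _ ?_
  · rw [unitMulEquiv_apply, hB', hB', units_mul_mem_iff]
  · exact (map_ne_zero σ).2 (units_coe_ne_zero ε)
  · exact map_mul σ _ _
  · intro γ α hγ hα j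
    exact im_div_ne_zero_of_isNormalVector σ h_nonreal B' _ hγ hα j

end Arithmetic

end

end MultEllGamma

theorem lemma24 {K : Type*} [Field K] [NumberField K] {r : ℕ} (σ : ATROrdering K r)
    (𝔣 𝔟 𝔞 : Ideal (NumberField.RingOfIntegers K))
    (hf_bot : 𝔣 ≠ ⊥) (hf_top : 𝔣 ≠ ⊤)
    (hb : IsCoprime 𝔟 𝔣) (ha : IsCoprime 𝔞 (𝔣 * 𝔟))
    (ha_smoothing : ∃ g, GeneratesQuotient (idealAL 𝔣 𝔟 𝔞) (idealL 𝔣 𝔟) g)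
    (B B' : Module.Basis (Fin (r + 2)) ℚ K)
    (hB : IsIntegralBasisOf B (idealL 𝔣 𝔟)) (hB_pos : IsPositiveBasis σ B)
    (hB' : IsIntegralBasisOf B' (idealAL 𝔣 𝔟 𝔞)) (hB'_pos : IsPositiveBasis σ B')
    (h : K) (hh : IsAdmissible 𝔣 𝔟 𝔞 h)
    (u : Fin r → (NumberField.RingOfIntegers K)ˣ)
    (hu : LinearIndependent ℚ (unitFamily u))
    (h_nonreal : ∀ α, IsPositiveDualFamily B (formFamily B u h) α →
      ∀ j, (σ.sigmaC (α j / h)).im ≠ 0)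
    (μ ν : ℤˣ) (ε : (NumberField.RingOfIntegers K)ˣ) :
    arithG σ 𝔣 𝔞 B B' μ u ((ε : NumberField.RingOfIntegers K) * h) ^ (ν : ℤ) =
      arithG σ 𝔣 𝔞 B B' (μ * Units.map (Algebra.norm ℤ) ε) u h ^
        ((ν * Units.map (Algebra.norm ℤ) ε : ℤˣ) : ℤ) := by
  -- The forms come from `L` in both cases; for `𝔞⁻¹L` their integrality rests on admissibility of
  -- `h`.
  have hL := geomG_formFamily_units_mul σ.sigmaC h_nonreal hB hB
    (formFamily_mem_dualLattice hB) μ ε (levelQ 𝔣 : K)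
  have hAL := geomG_formFamily_units_mul σ.sigmaC h_nonreal hB hB'
    (formFamily_mem_dualLattice_of_generatesQuotient hB hB' hh.2.2) μ ε (levelQ 𝔣 : K)
  rw [arithG, hL, hAL, arithG, mul_comm ν, Units.val_mul _ ν, zpow_mul]
  congr 1
  rw [div_zpow, ← zpow_natCast, ← zpow_natCast, ← zpow_mul, ← zpow_mul,
    mul_comm (Ideal.absNorm 𝔞 : ℤ)]
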